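/- Let $p$ be a prime number, and put $q=p$ if $p$ is odd and $q=4$ if $p=2$. Let $\omega$ be the Teichmüller character of conductor $q$: for an integer $a$ prime to $p$, $\omega(a)\in\mathbb{Z}_p$ is the root of unity with $\omega(a)^{\varphi(q)}=1$ and $\omega(a)\equiv a \bmod q$. Put $\langle a\rangle=\omega(a)^{-1}a$, and for $t\in\mathbb{C}_p$ with $|t|<qp^{-1/(p-1)}$ put $\langle a\rangle^{t}=\sum_{j\ge 0}\binom{t}{j}(\langle a\rangle-1)^j$. For a primitive even Dirichlet character $\chi$ of conductor $f$ with values in $\mathbb{C}_p$, let $L_p(s,\chi)$ be the $p$-adic $L$-function on $\{s\in\mathbb{C}_p : |s|<qp^{-1/(p-1)}\}$, given for $s\neq 1$ by $$L_p(s,\chi)=\frac1F\,\frac1{s-1}\sum_{\substack{a=1\\ p\nmid a}}^{F}\chi(a)\langle a\rangle^{1-s}\sum_{j=0}^{\infty}\binom{1-s}{j}\Big(\frac Fa\Big)^jB_j ,\qquad F=\mathrm{lcm}(q,f),$$ with the Bernoulli numbers $B_j$ ($B_1=-\tfrac12$), and by $L_p(1,\chi)=\lim_{s\to1}L_p(s,\chi)$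 if $\chi\ne1$. Let $\chi$ be an even primitive Dirichlet character of conductor $f=dp^m$ with $d \geq 1$, $m\ge 0$, $(d,p)=1$ and $(3,dp)=1$. If $d\equiv1 \bmod 3$, let $(\epsilon_a)_{a\ge0}$ be the sequence of period $3$ with $\epsilon_0=1$, $\epsilon_1=-1$, $\epsilon_2=0$; otherwise let it be the sequence of period $3$ with $\epsilon_0=1$, $\epsilon_1=0$, $\epsilon_2=-1$. Then for every $s\in\mathbb{C}_p$ with $|s|<qp^{-1/(p-1)}$ (and $s\neq1$ if $\chi=1$), $$-\big(1-\chi(3)\langle3\rangle^{1-s}\big)L_p(s,\chi)=\lim_{n\to\infty}\ \sum_{\substack{a=1\\ p\nmid a}}^{dp^{2n}}\chi\omega^{-1}(a)\,\frac{\epsilon_a}{\langle a\rangle^{s}} .$$ -/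

import Mathlib

open Filter Topology

noncomputable section

namespace PadicDirichlet

/-- The standard modulus `q` attached to `p`: `q = p` if `p` is odd, and `q = 4` if `p = 2`. -/
def q (p : ℕ) : ℕ := if p = 2 then 4 else p

/-- The Teichmüller character with values in `ℤ_p`. For odd `p` this is the multiplicative
lift of `a mod p`, transported along the isomorphism of the Witt vectors of `𝔽_p` with `ℤ_p`;
for `p = 2` it is the sign `±1` congruent to `a` modulo `4`. It vanishes when `p ∣ a`. -/
def teichmullerInt (p : ℕ) [Fact p.Prime] (a : ℕ) : ℤ_[p] :=
  if p = 2 then ((ZMod.χ₄ (a : ZMod 4) : ℤ) : ℤ_[p])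
  else WittVector.equiv p (WittVector.teichmuller p (a : ZMod p))

/-- The values of the Teichmüller character are roots of unity of order dividing `φ(q)` ... -/
theorem teichmullerInt_pow (p : ℕ) [hp : Fact p.Prime] (a : ℕ) (ha : ¬ p ∣ a) :
    teichmullerInt p a ^ (q p).totient = 1 := by
  unfold teichmullerInt q
  split_ifs with h
  · subst h
    have h4 : a % 4 = 1 ∨ a % 4 = 3 := by omega
    have ht : Nat.totient 4 = 2 := by decide
    rcases h4 with h4 | h4
    · rw [ZMod.χ₄_nat_one_mod_four h4]; simp
    · rw [ZMod.χ₄_nat_three_mod_four h4, ht]; simp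
  · have hne : (a : ZMod p) ≠ 0 := by rwa [Ne, ZMod.natCast_eq_zero_iff]
    rw [← map_pow, ← map_pow, Nat.totient_prime hp.out, ZMod.pow_card_sub_one_eq_one hne]
    simp

/-- ... and `ω(a) ≡ a` modulo `q`. These two properties determine `ω(a)`. -/
theorem teichmullerInt_congr (p : ℕ) [hp : Fact p.Prime] (a : ℕ) (ha : ¬ p ∣ a) :
    ((q p : ℕ) : ℤ_[p]) ∣ (a : ℤ_[p]) - teichmullerInt p a := by
  unfold teichmullerInt q
  split_ifs with h
  · subst h
    have h4 : a % 4 = 1 ∨ a % 4 = 3 := by omega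
    have key : (4 : ℤ) ∣ (a : ℤ) - ZMod.χ₄ (a : ZMod 4) := by
      rcases h4 with h4 | h4
      · rw [ZMod.χ₄_nat_one_mod_four h4]; omega
      · rw [ZMod.χ₄_nat_three_mod_four h4]; omega
    have := map_dvd (Int.castRingHom ℤ_[2]) key
    simpa using this
  · have hcomp : (PadicInt.toZMod (p := p)).comp
        (WittVector.equiv p : WittVector p (ZMod p) →+* ℤ_[p]) =
        WittVector.constantCoeff := by
      have hsub : ∀ f g : ℤ_[p] →+* ZMod p, f = g := by
        intro f g
        ext x
        have h1 := PadicInt.toZMod_spec x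
        rw [PadicInt.maximalIdeal_eq_span_p, Ideal.mem_span_singleton] at h1
        have e : ∀ f : ℤ_[p] →+* ZMod p, f x = PadicInt.toZMod x := by
          intro f
          have h2 := map_dvd f h1
          rw [map_natCast, CharP.cast_eq_zero, zero_dvd_iff, map_sub, sub_eq_zero] at h2
          rw [h2, ← ZMod.natCast_val, map_natCast, ZMod.natCast_zmod_val]
        rw [e f, e g]
      have := hsub PadicInt.toZMod (WittVector.constantCoeff.comp
        ((WittVector.equiv p).symm : ℤ_[p] →+* WittVector p (ZMod p)))
      rw [this]
      ext x
      simp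
    have h1 : (a : ℤ_[p]) - WittVector.equiv p (WittVector.teichmuller p (a : ZMod p)) ∈
        RingHom.ker (PadicInt.toZMod (p := p)) := by
      rw [RingHom.mem_ker, map_sub, map_natCast, sub_eq_zero]
      have := congrArg (fun f => f (WittVector.teichmuller p (a : ZMod p))) hcomp
      simp [WittVector.teichmuller_coeff_zero] at this
      exact this.symm
    rw [PadicInt.ker_toZMod, PadicInt.maximalIdeal_eq_span_p, Ideal.mem_span_singleton] at h1
    exact h1

/-- The Teichmüller character `ω`, with values in `ℂ_p`. -/
def omega (p : ℕ) [Fact p.Prime] (a : ℕ) : ℂ_[p] :=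
  algebraMap ℚ_[p] ℂ_[p] (teichmullerInt p a : ℚ_[p])

/-- `⟨a⟩ = ω(a)⁻¹ a`, for `a` prime to `p`. -/
def angle (p : ℕ) [Fact p.Prime] (a : ℕ) : ℂ_[p] := (omega p a)⁻¹ * (a : ℂ_[p])

/-- The `p`-adic power `x ^ t = ∑_j binom(t, j) (x - 1) ^ j`; the series converges for
`|x - 1| ≤ 1 / q` and `|t| < q p ^ (-1 / (p - 1))`. -/
def padicPow (p : ℕ) [Fact p.Prime] (x t : ℂ_[p]) : ℂ_[p] :=
  ∑' j : ℕ, Ring.choose t j * (x - 1) ^ j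

/-- The radius `q p ^ (-1 / (p - 1))` of the disc on which `p`-adic `L`-functions live. -/
def radius (p : ℕ) : ℝ := (q p : ℝ) * (p : ℝ) ^ (-(1 / ((p : ℝ) - 1)))

/-- The `p`-adic partial zeta function
`H_p(s, a, F) = (1 / (s - 1)) (1 / F) ⟨a⟩ ^ (1 - s) ∑_j binom(1 - s, j) (F / a) ^ j B_j`,
where `B_1 = -1/2`, for `p ∤ a`, `q ∣ F` and `s ≠ 1`. -/
def partialZeta (p : ℕ) [Fact p.Prime] (s : ℂ_[p]) (a F : ℕ) : ℂ_[p] :=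
  (1 / (s - 1)) * (1 / (F : ℂ_[p])) * padicPow p (angle p a) (1 - s) *
    ∑' j : ℕ, Ring.choose (1 - s) j * ((F : ℂ_[p]) / (a : ℂ_[p])) ^ j *
      ((bernoulli j : ℚ) : ℂ_[p])

/-- The sum `∑ χ(a) H_p(s, a, F)` over `1 ≤ a ≤ F` with `p ∤ a`, for `s ≠ 1`. -/
def zetaSum (p : ℕ) [Fact p.Prime] {f : ℕ} (χ : DirichletCharacter ℂ_[p] f) (F : ℕ)
    (s : ℂ_[p]) : ℂ_[p] :=
  ∑ a ∈ Finset.Icc 1 F with ¬ p ∣ a, χ (a : ZMod f) * partialZeta p s a F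

open Classical in
/-- The `p`-adic `L`-function `L_p(s, χ)` of a primitive Dirichlet character `χ` modulo `f`,
on the disc `|s| < q p ^ (-1 / (p - 1))`, built from the partial zeta functions with
`F = lcm(q, f)`. At `s = 1` the explicit expression has a vanishing denominator, and the value
is the limit for `s → 1` (which exists for `χ ≠ 1`; for `χ = 1` there is a pole at `s = 1`). -/
def padicL (p : ℕ) [Fact p.Prime] {f : ℕ} (χ : DirichletCharacter ℂ_[p] f)
    (s : ℂ_[p]) : ℂ_[p] :=
  if s = 1 then limUnder (𝓝[≠] (1 : ℂ_[p])) (zetaSum p χ (Nat.lcm (q p) f))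
  else zetaSum p χ (Nat.lcm (q p) f) s

/-- The sequence of period `3` which starts with `1, -1, 0` at `a = 0, 1, 2` if
`d ≡ 1 mod 3`, and with `1, 0, -1` otherwise. -/
def eps (d a : ℕ) : ℤ :=
  if a % 3 = 0 then 1
  else if a % 3 = 1 then (if d % 3 = 1 then -1 else 0)
  else (if d % 3 = 1 then 0 else -1)

end PadicDirichlet

end

/-!
Write `t = 1 - s` and `φ(a) = χ(a) ⟨a⟩ ^ t` for `a` prime to `p`, with `φ(a) = 0` otherwise
(`twist`).

The Bernoulli numbers are the `p`-adic limits of `p ^ (-N) ∑_{x < p ^ N} x ^ j`, and these averages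
are bounded by `p` in norm (`tendsto_powerMean`, `norm_powerMean_le`). Averaging the binomial series
of `(1 + x F / a) ^ t` over `x` term by term, and using that `x ^ t` is multiplicative in `x`
(`padicPow_mul`), one gets `(s - 1) L_p(s, χ) = lim F⁻¹ ∑_{a ≤ F} φ(a)` along `F = d p ^ N`
(`tendsto_mean_twist`).

Now `φ(3 a) = χ(3) ⟨3⟩ ^ t φ(a)`, and multiplication by `3` permutes the residues modulo `F`: each
`3 a` is `r + k F` with `1 ≤ r ≤ F` and `k ∈ {0, 1, 2}` determined by `r` modulo `3`
(`sum_three_mul`). By Taylor expansion `φ(r + k F) = φ(r) + t k F φ(r) / r + O(F ^ 2)`, so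
`(1 - χ(3) ⟨3⟩ ^ t) F⁻¹ ∑ φ(a) = -t ∑ k φ(r) / r + O(F)` (`norm_mean_twist_add_le`). Since `χ` is
even, `φ(r) / r` is odd under `r ↦ F - r` up to `O(F)`, so `∑ φ(r) / r` tends to zero
(`norm_two_mul_sum_twist_div_le`), and `k` may be replaced by `k - 1`. If `F ≡ d` modulo `3`, which
holds for `F = d p ^ (2 n)`, then `1 - k` is `ε_r`. As `φ(r) / r = χ(r) ω(r)⁻¹ ⟨r⟩ ^ (-s)`, dividing
by `t` gives the claim for `s ≠ 1`.

At `s = 1` and `χ ≠ 1` the zeta sum is the difference quotient at `t = 0` of a function that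
is differentiable there and vanishes by orthogonality, so it has a limit
(`exists_tendsto_zetaSum`). The finite sums are equicontinuous at `s = 1`
(`norm_sum_eps_twist_sub_le`), and the claim follows by letting `s` tend to `1`.
-/

noncomputable section

namespace PadicDirichlet

variable {p : ℕ} [Fact p.Prime]

/-! ### Norms and the radius of convergence -/

theorem q_pos : 0 < q p := by
  have := (Fact.out : p.Prime).pos
  unfold q; split_ifs <;> omega

theorem dvd_q : p ∣ q p := by
  unfold q; split_ifs with h
  · subst h; norm_num
  · exact dvd_rfl

theorem norm_sub_le_max (x y : ℂ_[p]) : ‖x - y‖ ≤ max ‖x‖ ‖y‖ := by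
  simpa [sub_eq_add_neg] using IsUltrametricDist.norm_add_le_max x (-y)

theorem norm_natCast_eq (n : ℕ) : ‖(n : ℂ_[p])‖ = ‖(n : ℚ_[p])‖ := by
  rw [← map_natCast (algebraMap ℚ_[p] ℂ_[p]), norm_algebraMap']

theorem norm_natCast_p : ‖(p : ℂ_[p])‖ = (p : ℝ)⁻¹ := by
  rw [norm_natCast_eq, Padic.norm_p]

theorem norm_q : ‖((q p : ℕ) : ℂ_[p])‖ = (q p : ℝ)⁻¹ := by
  unfold q; split_ifs with h
  · subst h
    have : ((4 : ℕ) : ℂ_[2]) = ((2 : ℕ) : ℂ_[2]) ^ 2 := by norm_num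
    rw [this, norm_pow, norm_natCast_p]; norm_num
  · exact norm_natCast_p

theorem norm_natCast_le_of_dvd {m n : ℕ} (h : m ∣ n) : ‖(n : ℂ_[p])‖ ≤ ‖(m : ℂ_[p])‖ := by
  obtain ⟨k, rfl⟩ := h
  rw [Nat.cast_mul, norm_mul]
  exact mul_le_of_le_one_right (norm_nonneg _) (IsUltrametricDist.norm_natCast_le_one _ _)

theorem norm_natCast_eq_one {a : ℕ} (ha : ¬ p ∣ a) : ‖(a : ℂ_[p])‖ = 1 := by
  rw [norm_natCast_eq, Padic.norm_natCast_eq_one_iff]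
  exact ((Nat.Prime.coprime_iff_not_dvd Fact.out).2 ha)

theorem radius_pos : 0 < radius p :=
  mul_pos (by exact_mod_cast q_pos) (Real.rpow_pos_of_pos
    (by exact_mod_cast (Fact.out : p.Prime).pos) _)

theorem q_div_radius : (q p : ℝ) / radius p = (p : ℝ) ^ (1 / ((p : ℝ) - 1)) := by
  have hq : (q p : ℝ) ≠ 0 := by exact_mod_cast q_pos.ne'
  have hp : (0 : ℝ) < p := by exact_mod_cast (Fact.out : p.Prime).pos
  unfold radius
  rw [Real.rpow_neg hp.le]
  field_simp

theorem one_lt_radius : 1 < radius p := by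
  have hp2 : (2 : ℝ) ≤ p := by exact_mod_cast (Fact.out : p.Prime).two_le
  have hq : (0 : ℝ) < q p := by exact_mod_cast q_pos
  have h : (p : ℝ) ^ (1 / ((p : ℝ) - 1)) < q p := by
    by_cases h2 : p = 2
    · subst h2; norm_num [q]
    · have h3 : (3 : ℝ) ≤ p := by
        have := (Fact.out : p.Prime).two_le
        exact_mod_cast (by omega : 3 ≤ p)
      rw [q, if_neg h2]
      conv_rhs => rw [← Real.rpow_one (p : ℝ)]
      apply Real.rpow_lt_rpow_of_exponent_lt (by linarith)
      rw [div_lt_one (by linarith)]; linarith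
  rw [← q_div_radius, div_lt_iff₀ radius_pos] at h
  exact lt_of_mul_lt_mul_left (by linarith) hq.le

/-- By Legendre's formula, `|n!|⁻¹ ≤ p ^ (n / (p - 1))`. -/
theorem norm_factorial_inv_le (n : ℕ) :
    ‖((n.factorial : ℕ) : ℂ_[p])‖⁻¹ ≤ ((q p : ℝ) / radius p) ^ n := by
  have hp2 : (2 : ℝ) ≤ p := by exact_mod_cast (Fact.out : p.Prime).two_le
  have hp0 : (p : ℝ) ≠ 0 := by linarith
  have hn : ((n.factorial : ℕ) : ℚ_[p]) ≠ 0 := by exact_mod_cast n.factorial_ne_zero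
  rw [q_div_radius, norm_natCast_eq, Padic.norm_eq_zpow_neg_valuation hn, ← zpow_neg, neg_neg,
    Padic.valuation_natCast, ← Real.rpow_natCast, ← Real.rpow_mul (by linarith),
    ← Real.rpow_intCast]
  apply Real.rpow_le_rpow_of_exponent_le (by linarith)
  rw [div_mul_eq_mul_div, le_div_iff₀ (by linarith), one_mul]
  have h := sub_one_mul_padicValNat_factorial (p := p) n
  have h' : (p - 1) * padicValNat p n.factorial ≤ n := by omega
  have h'' : (((p - 1) * padicValNat p n.factorial : ℕ) : ℝ) ≤ n := by exact_mod_cast h'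
  rw [Nat.cast_mul, Nat.cast_sub (Fact.out : p.Prime).one_le] at h''
  rw [Int.cast_natCast]
  rw [Nat.cast_one] at h''
  linarith

theorem choose_eq_prod (t : ℂ_[p]) (n : ℕ) :
    Ring.choose t n = ((n.factorial : ℕ) : ℂ_[p])⁻¹ * ∏ i ∈ Finset.range n, (t - i) := by
  rw [Ring.choose_eq_smul, smul_eq_mul, ← descPochhammer_eval_eq_prod_range,
    ← Polynomial.aeval_eq_smeval, ← Polynomial.eval_map_algebraMap, descPochhammer_map]

variable (p) in
/-- The ratio of the geometric series that dominates `∑ binom(t, j) u ^ j` for `|u| ≤ 1 / q`. -/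
def ratio (t : ℂ_[p]) : ℝ := max ‖t‖ 1 / radius p

theorem ratio_nonneg (t : ℂ_[p]) : 0 ≤ ratio p t := by
  have := radius_pos (p := p)
  unfold ratio; positivity

theorem ratio_lt_one {t : ℂ_[p]} (ht : ‖t‖ < radius p) : ratio p t < 1 := by
  rw [ratio, div_lt_one radius_pos]
  exact max_lt ht one_lt_radius

theorem norm_sub_natCast_le (t : ℂ_[p]) (i : ℕ) : ‖t - i‖ ≤ max ‖t‖ 1 :=
  (norm_sub_le_max _ _).trans
    (max_le_max le_rfl (IsUltrametricDist.norm_natCast_le_one _ _))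

theorem ratio_mul_q (t : ℂ_[p]) : ratio p t * q p = q p / radius p * max ‖t‖ 1 := by
  have hr := (radius_pos (p := p)).ne'
  rw [ratio]; field_simp

theorem norm_choose_le (t : ℂ_[p]) (j : ℕ) : ‖Ring.choose t j‖ ≤ (ratio p t * q p) ^ j := by
  rw [ratio_mul_q, mul_pow, choose_eq_prod, norm_mul, norm_inv, norm_prod]
  refine mul_le_mul (norm_factorial_inv_le j) ?_ (by positivity)
    (pow_nonneg (div_nonneg (Nat.cast_nonneg _) radius_pos.le) _)
  calc _ ≤ ∏ i ∈ Finset.range j, max ‖t‖ 1 :=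
        Finset.prod_le_prod (fun _ _ => norm_nonneg _) fun i _ => norm_sub_natCast_le t i
    _ = _ := by simp

/-- The factor `t` of `binom(t, j)`, for `j ≥ 1`, makes the bound proportional to `|t|`. -/
theorem norm_choose_succ_le (t : ℂ_[p]) (j : ℕ) :
    ‖Ring.choose t (j + 1)‖ ≤ ‖t‖ * (ratio p t * q p) ^ (j + 1) := by
  rw [ratio_mul_q, mul_pow, choose_eq_prod, norm_mul, norm_inv, norm_prod, mul_left_comm]
  refine mul_le_mul (norm_factorial_inv_le _) ?_ (by positivity)
    (pow_nonneg (div_nonneg (Nat.cast_nonneg _) radius_pos.le) _)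
  rw [Finset.prod_range_succ', mul_comm, Nat.cast_zero, sub_zero]
  gcongr
  calc _ ≤ ∏ i ∈ Finset.range j, max ‖t‖ 1 :=
        Finset.prod_le_prod (fun _ _ => norm_nonneg _) fun i _ => norm_sub_natCast_le t _
    _ = max ‖t‖ 1 ^ j := by simp
    _ ≤ _ := pow_le_pow_right₀ (le_max_right _ _) j.le_succ

theorem norm_choose_mul_pow_le (t : ℂ_[p]) (u : ℂ_[p]) (j : ℕ) :
    ‖Ring.choose t j * u ^ j‖ ≤ ratio p t ^ j * (q p * ‖u‖) ^ j := by
  rw [norm_mul, norm_pow, ← mul_pow, ← mul_assoc, mul_pow]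
  gcongr
  exact norm_choose_le t j

theorem norm_choose_succ_mul_pow_le (t : ℂ_[p]) (u : ℂ_[p]) (j : ℕ) :
    ‖Ring.choose t (j + 1) * u ^ (j + 1)‖ ≤
      ‖t‖ * (ratio p t ^ (j + 1) * (q p * ‖u‖) ^ (j + 1)) := by
  rw [norm_mul, norm_pow, ← mul_pow, ← mul_assoc, mul_pow, ← mul_assoc]
  gcongr
  exact norm_choose_succ_le t j

theorem q_mul_norm_le_one {u : ℂ_[p]} (hu : ‖u‖ ≤ (q p : ℝ)⁻¹) : q p * ‖u‖ ≤ 1 := by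
  have hq : (0 : ℝ) < q p := by exact_mod_cast q_pos
  rwa [mul_comm, ← le_div_iff₀ hq, one_div]

theorem norm_choose_mul_pow_le_ratio (t : ℂ_[p]) {u : ℂ_[p]} (hu : ‖u‖ ≤ (q p : ℝ)⁻¹) (j : ℕ) :
    ‖Ring.choose t j * u ^ j‖ ≤ ratio p t ^ j :=
  (norm_choose_mul_pow_le t u j).trans <|
    mul_le_of_le_one_right (pow_nonneg (ratio_nonneg t) _)
      (pow_le_one₀ (by positivity) (q_mul_norm_le_one hu))

theorem summable_norm_choose_mul_pow {t u : ℂ_[p]} (ht : ‖t‖ < radius p)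
    (hu : ‖u‖ ≤ (q p : ℝ)⁻¹) : Summable fun j => ‖Ring.choose t j * u ^ j‖ :=
  Summable.of_nonneg_of_le (fun _ => norm_nonneg _) (norm_choose_mul_pow_le_ratio t hu)
    (summable_geometric_of_lt_one (ratio_nonneg t) (ratio_lt_one ht))

theorem norm_tsum_le_of_forall_le {f : ℕ → ℂ_[p]} {C : ℝ} (h : ∀ j, ‖f j‖ ≤ C) :
    ‖∑' j, f j‖ ≤ C :=
  (IsUltrametricDist.norm_tsum_le f).trans (ciSup_le h)

/-! ### The `p`-adic power -/

theorem padicPow_eq_one_add {t x : ℂ_[p]} (ht : ‖t‖ < radius p) (hx : ‖x - 1‖ ≤ (q p : ℝ)⁻¹) :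
    padicPow p x t = 1 + ∑' j : ℕ, Ring.choose t (j + 1) * (x - 1) ^ (j + 1) := by
  rw [padicPow, (summable_norm_choose_mul_pow ht hx).of_norm.tsum_eq_zero_add]
  simp

theorem norm_padicPow_sub_one_le {t x : ℂ_[p]} (ht : ‖t‖ < radius p)
    (hx : ‖x - 1‖ ≤ (q p : ℝ)⁻¹) : ‖padicPow p x t - 1‖ ≤ ‖t‖ := by
  rw [padicPow_eq_one_add ht hx, add_sub_cancel_left]
  refine norm_tsum_le_of_forall_le fun j => (norm_choose_succ_mul_pow_le t _ j).trans ?_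
  refine mul_le_of_le_one_right (norm_nonneg _) (mul_le_one₀ ?_ (by positivity) ?_)
  · exact pow_le_one₀ (ratio_nonneg t) (ratio_lt_one ht).le
  · exact pow_le_one₀ (by positivity) (q_mul_norm_le_one hx)

theorem norm_padicPow_sub_one_le' {t x : ℂ_[p]} (ht : ‖t‖ < radius p)
    (hx : ‖x - 1‖ ≤ (q p : ℝ)⁻¹) : ‖padicPow p x t - 1‖ ≤ q p * ‖x - 1‖ := by
  rw [padicPow_eq_one_add ht hx, add_sub_cancel_left]
  refine norm_tsum_le_of_forall_le fun j => (norm_choose_mul_pow_le t _ _).trans ?_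
  refine (mul_le_of_le_one_left (by positivity)
    (pow_le_one₀ (ratio_nonneg t) (ratio_lt_one ht).le)).trans ?_
  exact pow_le_of_le_one (by positivity) (q_mul_norm_le_one hx) (by omega)

/-- The Taylor expansion of `x ^ t` at `x = 1`, to first order. -/
theorem norm_padicPow_sub_one_sub_le {t x : ℂ_[p]} (ht : ‖t‖ < radius p)
    (hx : ‖x - 1‖ ≤ (q p : ℝ)⁻¹) :
    ‖padicPow p x t - 1 - t * (x - 1)‖ ≤ (q p * ‖x - 1‖) ^ 2 := by
  have hs : Summable fun j : ℕ => Ring.choose t (j + 1) * (x - 1) ^ (j + 1) :=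
    (summable_norm_choose_mul_pow ht hx).of_norm.comp_injective (add_left_injective 1)
  rw [padicPow_eq_one_add ht hx, add_sub_cancel_left, hs.tsum_eq_zero_add]
  simp only [zero_add, Ring.choose_one_right, pow_one, add_sub_cancel_left]
  refine norm_tsum_le_of_forall_le fun j => (norm_choose_mul_pow_le t _ _).trans ?_
  refine (mul_le_of_le_one_left (by positivity)
    (pow_le_one₀ (ratio_nonneg t) (ratio_lt_one ht).le)).trans ?_
  exact pow_le_pow_of_le_one (by positivity) (q_mul_norm_le_one hx) (by omega)

theorem norm_padicPow_le_one {t x : ℂ_[p]} (ht : ‖t‖ < radius p) (hx : ‖x - 1‖ ≤ (q p : ℝ)⁻¹) :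
    ‖padicPow p x t‖ ≤ 1 := by
  refine norm_tsum_le_of_forall_le fun j => (norm_choose_mul_pow_le_ratio t hx j).trans ?_
  exact pow_le_one₀ (ratio_nonneg t) (ratio_lt_one ht).le

theorem padicPow_zero (x : ℂ_[p]) : padicPow p x 0 = 1 := by
  rw [padicPow, tsum_eq_single 0]
  · simp
  · intro j hj
    rw [Ring.choose_zero_pos _ (Nat.pos_of_ne_zero hj), zero_mul]

theorem padicPow_natCast (x : ℂ_[p]) (n : ℕ) : padicPow p x n = x ^ n := by
  rw [padicPow, tsum_eq_sum (s := Finset.range (n + 1))]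
  · conv_rhs => rw [← sub_add_cancel x 1, add_pow]
    refine Finset.sum_congr rfl fun j _ => ?_
    rw [Ring.choose_natCast, one_pow, mul_one, mul_comm]
  · intro j hj
    rw [Ring.choose_natCast, Nat.choose_eq_zero_of_lt (by simpa using hj), Nat.cast_zero, zero_mul]

theorem padicPow_add {s t x : ℂ_[p]} (hs : ‖s‖ < radius p) (ht : ‖t‖ < radius p)
    (hx : ‖x - 1‖ ≤ (q p : ℝ)⁻¹) :
    padicPow p x (s + t) = padicPow p x s * padicPow p x t := by
  unfold padicPow
  rw [tsum_mul_tsum_eq_tsum_sum_antidiagonal_of_summable_norm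
    (summable_norm_choose_mul_pow hs hx) (summable_norm_choose_mul_pow ht hx)]
  refine tsum_congr fun n => ?_
  rw [Ring.add_choose_eq n (Commute.all s t), Finset.sum_mul]
  refine Finset.sum_congr rfl fun ij hij => ?_
  rw [← Finset.HasAntidiagonal.mem_antidiagonal.1 hij, pow_add]
  ring

theorem norm_sub_natCast_lt {t : ℂ_[p]} (ht : ‖t‖ < radius p) (i : ℕ) : ‖t - i‖ < radius p :=
  (norm_sub_natCast_le t i).trans_lt (max_lt ht one_lt_radius)

/-- Expand `(1 + u) (1 + v) - 1 = u (1 + v) + v` binomially in each term of the series: the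
coefficient of `u ^ i` is `binom(t, i) (1 + v) ^ i (1 + v) ^ (t - i)`. -/
theorem padicPow_mul {t x y : ℂ_[p]} (ht : ‖t‖ < radius p)
    (hx : ‖x - 1‖ ≤ (q p : ℝ)⁻¹) (hy : ‖y - 1‖ ≤ (q p : ℝ)⁻¹) :
    padicPow p (x * y) t = padicPow p x t * padicPow p y t := by
  have hq1 : (q p : ℝ)⁻¹ ≤ 1 := inv_le_one_of_one_le₀ (by exact_mod_cast q_pos)
  have hy1 : ‖y‖ ≤ 1 := by
    rw [← sub_add_cancel y 1]
    exact (IsUltrametricDist.norm_add_le_max _ _).trans (max_le (hy.trans hq1) (by simp))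
  have hu : ‖(x - 1) * y‖ ≤ (q p : ℝ)⁻¹ := by
    rw [norm_mul]
    exact (mul_le_of_le_one_right (norm_nonneg _) hy1).trans hx
  set c : ℕ × ℕ → ℂ_[p] := fun ik => Ring.choose t ik.1 * ((x - 1) * y) ^ ik.1 *
    (Ring.choose (t - ik.1) ik.2 * (y - 1) ^ ik.2) with hc
  have hrew (i k : ℕ) : c (i, k) = ((i + k).choose i : ℂ_[p]) *
      (Ring.choose t (i + k) * ((x - 1) * y) ^ i * (y - 1) ^ k) := by
    have := Ring.choose_smul_choose t (Nat.le_add_right i k)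
    rw [Nat.add_sub_cancel_left, nsmul_eq_mul] at this
    simp only [hc]
    linear_combination (-((x - 1) * y) ^ i * (y - 1) ^ k) * this
  have hsum : Summable c := by
    refine Summable.of_norm_bounded (g := fun ik : ℕ × ℕ => ratio p t ^ ik.1 * ratio p t ^ ik.2)
      ?_ ?_
    · have h := summable_geometric_of_lt_one (ratio_nonneg t) (ratio_lt_one ht)
      exact h.mul_of_nonneg h (fun _ => pow_nonneg (ratio_nonneg t) _)
        (fun _ => pow_nonneg (ratio_nonneg t) _)
    · rintro ⟨i, k⟩
      rw [hrew, norm_mul]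
      refine (mul_le_of_le_one_left (norm_nonneg _)
        (IsUltrametricDist.norm_natCast_le_one _ _)).trans ?_
      have hq : (0 : ℝ) < q p := by exact_mod_cast q_pos
      rw [mul_assoc, norm_mul, norm_mul, norm_pow, norm_pow]
      calc _ ≤ (ratio p t * q p) ^ (i + k) * ((q p : ℝ)⁻¹ ^ i * (q p : ℝ)⁻¹ ^ k) := by
            have := norm_choose_le t (i + k)
            have := mul_nonneg (ratio_nonneg t) hq.le
            gcongr
        _ = _ := by
            rw [← pow_add, ← mul_pow, mul_assoc, mul_inv_cancel₀ hq.ne', mul_one, pow_add]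
  have h1 : padicPow p (x * y) t = ∑' ik, c ik := by
    have hsum' : Summable fun z : Σ n : ℕ, Finset.HasAntidiagonal.antidiagonal n => c z.2 :=
      Finset.HasAntidiagonal.sigmaAntidiagonalEquivProd.summable_iff.2 hsum
    rw [← Finset.HasAntidiagonal.sigmaAntidiagonalEquivProd.tsum_eq c]
    refine Eq.trans ?_ (hsum'.tsum_sigma' fun n => (hasSum_fintype _).summable).symm
    refine tsum_congr fun n => ?_
    rw [tsum_fintype, show x * y - 1 = (x - 1) * y + (y - 1) by ring, add_pow, Finset.mul_sum,
      Finset.sum_coe_sort (Finset.HasAntidiagonal.antidiagonal n) (fun ik => c ik),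
      Finset.Nat.sum_antidiagonal_eq_sum_range_succ_mk]
    refine Finset.sum_congr rfl fun i hi => ?_
    have hi' : i ≤ n := Nat.lt_succ_iff.1 (Finset.mem_range.1 hi)
    rw [hrew, Nat.add_sub_cancel' hi']
    ring
  have hone (i : ℕ) : ‖((i : ℕ) : ℂ_[p])‖ < radius p :=
    (IsUltrametricDist.norm_natCast_le_one _ _).trans_lt one_lt_radius
  rw [h1, hsum.tsum_prod, padicPow, ← tsum_mul_right]
  refine tsum_congr fun i => ?_
  simp only [hc]
  rw [tsum_mul_left]
  change _ * padicPow p y (t - i) = _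
  rw [mul_pow, mul_assoc, mul_assoc, mul_assoc, ← padicPow_natCast y i,
    ← padicPow_add (hone i) (norm_sub_natCast_lt ht i) hy, add_sub_cancel]

/-! ### The Teichmüller character -/

theorem omega_mul (a b : ℕ) : omega p (a * b) = omega p a * omega p b := by
  unfold omega
  rw [← map_mul, ← PadicInt.coe_mul]
  congr 2
  unfold teichmullerInt
  split_ifs <;> push_cast <;> simp only [map_mul, Int.cast_mul] <;> rfl

theorem omega_congr {a b : ℕ} (h : a ≡ b [MOD q p]) : omega p a = omega p b := by
  unfold omega
  congr 2
  unfold teichmullerInt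
  unfold q at h
  split_ifs at h ⊢ with h2
  · rw [(ZMod.natCast_eq_natCast_iff _ _ _).2 h]
  · rw [(ZMod.natCast_eq_natCast_iff _ _ _).2 h]

theorem omega_one : omega p 1 = 1 := by
  unfold omega teichmullerInt
  split_ifs <;> simp

theorem norm_omega {a : ℕ} (ha : ¬ p ∣ a) : ‖omega p a‖ = 1 := by
  refine (pow_eq_one_iff_of_nonneg (norm_nonneg _) (Nat.totient_pos.2 (q_pos (p := p))).ne').1 ?_
  rw [← norm_pow, omega, ← map_pow, ← PadicInt.coe_pow, teichmullerInt_pow p a ha,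
    PadicInt.coe_one, map_one, norm_one]

theorem omega_ne_zero {a : ℕ} (ha : ¬ p ∣ a) : omega p a ≠ 0 := by
  rw [← norm_ne_zero_iff, norm_omega ha]; exact one_ne_zero

theorem norm_natCast_sub_omega_le {a : ℕ} (ha : ¬ p ∣ a) :
    ‖(a : ℂ_[p]) - omega p a‖ ≤ (q p : ℝ)⁻¹ := by
  obtain ⟨c, hc⟩ := teichmullerInt_congr p a ha
  have h : (a : ℂ_[p]) - omega p a = (q p : ℕ) * algebraMap ℚ_[p] ℂ_[p] (c : ℚ_[p]) := by
    have := congrArg (fun z : ℤ_[p] => algebraMap ℚ_[p] ℂ_[p] (z : ℚ_[p])) hc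
    simpa [omega] using this
  rw [h, norm_mul, norm_q, norm_algebraMap']
  exact mul_le_of_le_one_right (by positivity) (PadicInt.norm_le_one c)

theorem two_lt_q : 2 < q p := by
  have := (Fact.out : p.Prime).two_le
  unfold q; split_ifs <;> omega

theorem not_dvd_q_sub_one : ¬ p ∣ q p - 1 := fun h => by
  have h1 := (Nat.dvd_sub_iff_right (q_pos (p := p)) dvd_q).1 h
  exact (Fact.out : p.Prime).one_lt.ne' (Nat.dvd_one.1 h1)

/-- `ω` is odd: `ω(q - 1)` is a square root of `1` that is not congruent to `1` modulo `q`. -/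
theorem omega_q_sub_one : omega p (q p - 1) = -1 := by
  have hq := two_lt_q (p := p)
  have hsq : omega p (q p - 1) * omega p (q p - 1) = 1 := by
    rw [← omega_mul, ← omega_one]
    refine omega_congr ((Nat.modEq_iff_dvd' (Nat.mul_pos (by omega) (by omega))).2 ?_).symm
    obtain ⟨k, hk⟩ : ∃ k, q p = k + 2 := ⟨q p - 2, by omega⟩
    rw [hk]
    exact ⟨k, by simp only [Nat.add_succ_sub_one]; rw [Nat.sub_eq_iff_eq_add (by nlinarith)]; ring⟩
  rcases mul_self_eq_one_iff.1 hsq with h | h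
  · exfalso
    have h1 := norm_natCast_sub_omega_le (not_dvd_q_sub_one (p := p))
    rw [h] at h1
    have h2 : ‖(2 : ℂ_[p])‖ ≤ (q p : ℝ)⁻¹ := by
      have e : (2 : ℂ_[p]) = (q p : ℕ) - (((q p - 1 : ℕ) : ℂ_[p]) - 1) := by
        rw [Nat.cast_sub (by omega), Nat.cast_one]; ring
      rw [e]
      exact (norm_sub_le_max _ _).trans (max_le norm_q.le h1)
    by_cases hp : p = 2
    · subst hp
      have := norm_natCast_p (p := 2)
      rw [Nat.cast_ofNat] at this
      rw [this] at h2; norm_num [q] at h2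
    · have : ¬ p ∣ 2 := fun h => hp ((Nat.prime_dvd_prime_iff_eq Fact.out Nat.prime_two).1 h)
      have h3 := norm_natCast_eq_one this
      rw [Nat.cast_ofNat] at h3
      rw [h3] at h2
      have : (q p : ℝ)⁻¹ < 1 := inv_lt_one_of_one_lt₀ (by exact_mod_cast (by omega : 1 < q p))
      linarith
  · exact h

theorem omega_sub {F a : ℕ} (hF : q p ∣ F) (h : a ≤ F) : omega p (F - a) = -omega p a := by
  have : F - a ≡ (q p - 1) * a [MOD q p] := by
    have h0 : 1 ≤ q p := q_pos
    rw [← Int.natCast_modEq_iff, Int.modEq_iff_dvd]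
    obtain ⟨k, rfl⟩ := hF
    push_cast [h, h0]
    exact ⟨a - k, by ring⟩
  rw [omega_congr this, omega_mul, omega_q_sub_one, neg_one_mul]

/-! ### The projection to the principal units -/

theorem angle_mul (a b : ℕ) : angle p (a * b) = angle p a * angle p b := by
  unfold angle; rw [omega_mul, mul_inv]; push_cast; ring

theorem omega_mul_angle {a : ℕ} (ha : ¬ p ∣ a) : omega p a * angle p a = a := by
  rw [angle, mul_inv_cancel_left₀ (omega_ne_zero ha)]

theorem norm_angle {a : ℕ} (ha : ¬ p ∣ a) : ‖angle p a‖ = 1 := by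
  rw [angle, norm_mul, norm_inv, norm_omega ha, norm_natCast_eq_one ha, inv_one, one_mul]

theorem angle_ne_zero {a : ℕ} (ha : ¬ p ∣ a) : angle p a ≠ 0 := by
  rw [← norm_ne_zero_iff, norm_angle ha]; exact one_ne_zero

theorem norm_angle_sub_one_le {a : ℕ} (ha : ¬ p ∣ a) : ‖angle p a - 1‖ ≤ (q p : ℝ)⁻¹ := by
  have : angle p a - 1 = (omega p a)⁻¹ * (a - omega p a) := by
    rw [mul_sub, inv_mul_cancel₀ (omega_ne_zero ha), angle]
  rw [this, norm_mul, norm_inv, norm_omega ha, inv_one, one_mul]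
  exact norm_natCast_sub_omega_le ha

theorem natCast_ne_zero_of_not_dvd {a : ℕ} (ha : ¬ p ∣ a) : (a : ℂ_[p]) ≠ 0 := by
  rw [← norm_ne_zero_iff, norm_natCast_eq_one ha]; exact one_ne_zero

theorem norm_natCast_le_of_q_dvd {F : ℕ} (hF : q p ∣ F) : ‖(F : ℂ_[p])‖ ≤ (q p : ℝ)⁻¹ :=
  (norm_natCast_le_of_dvd hF).trans_eq norm_q

theorem norm_div_natCast {a : ℕ} (ha : ¬ p ∣ a) (x : ℂ_[p]) : ‖x / a‖ = ‖x‖ := by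
  rw [norm_div, norm_natCast_eq_one ha, div_one]

theorem angle_add_mul {F a : ℕ} (hF : q p ∣ F) (ha : ¬ p ∣ a) (k : ℕ) :
    angle p (a + k * F) = angle p a * (1 + k * (F / a : ℂ_[p])) := by
  have h : omega p (a + k * F) = omega p a := by
    refine omega_congr ?_
    have := (Nat.modEq_zero_iff_dvd.2 (hF.mul_left k)).add_left a
    simpa using this
  have ha' := natCast_ne_zero_of_not_dvd ha
  rw [angle, angle, h]
  push_cast
  field_simp

theorem angle_sub {F a : ℕ} (hF : q p ∣ F) (ha : ¬ p ∣ a) (h : a ≤ F) :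
    angle p (F - a) = angle p a * (1 - F / a : ℂ_[p]) := by
  have ha' := natCast_ne_zero_of_not_dvd ha
  rw [angle, angle, omega_sub hF h, Nat.cast_sub h, inv_neg]
  field_simp
  ring

theorem padicPow_angle_add_mul {F a : ℕ} (hF : q p ∣ F) (ha : ¬ p ∣ a) (k : ℕ) {t : ℂ_[p]}
    (ht : ‖t‖ < radius p) :
    padicPow p (angle p (a + k * F)) t =
      padicPow p (angle p a) t * padicPow p (1 + k * (F / a : ℂ_[p])) t := by
  rw [angle_add_mul hF ha, padicPow_mul ht (norm_angle_sub_one_le ha)]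
  rw [add_sub_cancel_left, norm_mul, norm_div_natCast ha]
  exact (mul_le_of_le_one_left (norm_nonneg _) (IsUltrametricDist.norm_natCast_le_one _ _)).trans
    (norm_natCast_le_of_q_dvd hF)

theorem padicPow_angle_sub {F a : ℕ} (hF : q p ∣ F) (ha : ¬ p ∣ a) (h : a ≤ F) {t : ℂ_[p]}
    (ht : ‖t‖ < radius p) :
    padicPow p (angle p (F - a)) t =
      padicPow p (angle p a) t * padicPow p (1 - F / a : ℂ_[p]) t := by
  rw [angle_sub hF ha h, padicPow_mul ht (norm_angle_sub_one_le ha)]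
  rw [sub_sub_cancel_left, norm_neg, norm_div_natCast ha]
  exact norm_natCast_le_of_q_dvd hF

/-! ### Volkenborn sums -/

theorem sum_range_mul_eq {M : Type*} [AddCommMonoid M] (g : ℕ → M) (F n : ℕ) :
    ∑ b ∈ Finset.range (F * n), g b =
      ∑ a ∈ Finset.range F, ∑ k ∈ Finset.range n, g (a + k * F) := by
  rw [Finset.sum_comm]
  induction n with
  | zero => simp
  | succ n ih =>
    rw [Nat.mul_succ, Finset.sum_range_add, ih, Finset.sum_range_succ]
    simp only [mul_comm F n, add_comm]

variable (p) in
/-- The average of `x ^ j` over `0 ≤ x < p ^ N`. -/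
def powerMean (N j : ℕ) : ℂ_[p] :=
  ((p ^ N : ℕ) : ℂ_[p])⁻¹ * ∑ x ∈ Finset.range (p ^ N), (x : ℂ_[p]) ^ j

theorem natCast_pow_ne_zero (N : ℕ) : ((p ^ N : ℕ) : ℂ_[p]) ≠ 0 := by
  exact_mod_cast (pow_pos (Fact.out : p.Prime).pos N).ne'

/-- Splitting the range by `x + y p ^ N` with `x < p ^ N` and `y < p`. The correction is a sum of
integers divided by `p`, which gives the uniform bound `norm_powerMean_le`. -/
theorem powerMean_succ (N j : ℕ) :
    powerMean p (N + 1) j = powerMean p N j + (p : ℂ_[p])⁻¹ * ∑ y ∈ Finset.range p,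
      ∑ x ∈ Finset.range (p ^ N), ((p ^ N : ℕ) : ℂ_[p])⁻¹ *
        (((x + y * p ^ N : ℕ) : ℂ_[p]) ^ j - (x : ℂ_[p]) ^ j) := by
  have hp : (p : ℂ_[p]) ≠ 0 := by exact_mod_cast (Fact.out : p.Prime).ne_zero
  have hN := natCast_pow_ne_zero (p := p) N
  simp only [← Finset.mul_sum, Finset.sum_sub_distrib, mul_sub, Finset.sum_const,
    Finset.card_range, nsmul_eq_mul]
  unfold powerMean
  rw [pow_succ, sum_range_mul_eq, Finset.sum_comm]
  push_cast at hN ⊢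
  field_simp
  ring

theorem norm_powerMean_le (N j : ℕ) : ‖powerMean p N j‖ ≤ p := by
  have hp1 : (1 : ℝ) ≤ p := by exact_mod_cast (Fact.out : p.Prime).one_le
  induction N with
  | zero =>
    refine le_trans ?_ hp1
    simp only [powerMean, pow_zero, Nat.cast_one, inv_one, one_mul, Finset.range_one,
      Finset.sum_singleton]
    exact_mod_cast IsUltrametricDist.norm_natCast_le_one ℂ_[p] (0 ^ j)
  | succ N ih =>
    rw [powerMean_succ]
    refine (IsUltrametricDist.norm_add_le_max _ _).trans (max_le ih ?_)
    rw [norm_mul, norm_inv, norm_natCast_p, inv_inv]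
    refine mul_le_of_le_one_right (by linarith) ?_
    refine IsUltrametricDist.norm_sum_le_of_forall_le_of_nonneg zero_le_one fun y _ => ?_
    refine IsUltrametricDist.norm_sum_le_of_forall_le_of_nonneg zero_le_one fun x _ => ?_
    obtain ⟨c, hc⟩ : ((p ^ N : ℕ) : ℤ) ∣ ((x + y * p ^ N : ℕ) : ℤ) ^ j - (x : ℤ) ^ j := by
      refine dvd_trans ?_ (sub_dvd_pow_sub_pow _ _ _)
      push_cast
      exact ⟨y, by ring⟩
    have hc' := congrArg (Int.cast : ℤ → ℂ_[p]) hc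
    push_cast at hc' ⊢
    have hN := natCast_pow_ne_zero (p := p) N
    push_cast at hN
    rw [hc', inv_mul_cancel_left₀ hN]
    exact IsUltrametricDist.norm_intCast_le_one _ _

theorem tendsto_natCast_pow_zero : Tendsto (fun N => ((p ^ N : ℕ) : ℂ_[p])) atTop (𝓝 0) := by
  simp only [Nat.cast_pow]
  refine tendsto_pow_atTop_nhds_zero_of_norm_lt_one ?_
  rw [norm_natCast_p]
  exact inv_lt_one_of_one_lt₀ (by exact_mod_cast (Fact.out : p.Prime).one_lt)

/-- Faulhaber's formula. -/
theorem powerMean_eq_sum_bernoulli (N j : ℕ) :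
    powerMean p N j = ∑ i ∈ Finset.range (j + 1), ((bernoulli i : ℚ) : ℂ_[p]) *
      ((j + 1).choose i) * ((p ^ N : ℕ) : ℂ_[p]) ^ (j - i) / (j + 1) := by
  have h := congrArg (Rat.cast : ℚ → ℂ_[p]) (sum_range_pow (p ^ N) j)
  push_cast at h
  have hN := natCast_pow_ne_zero (p := p) N
  push_cast at hN
  unfold powerMean
  push_cast
  rw [h, Finset.mul_sum]
  refine Finset.sum_congr rfl fun i hi => ?_
  have : j + 1 - i = (j - i) + 1 := by have := Finset.mem_range.1 hi; omega
  rw [this, pow_succ (_ : ℂ_[p]) (j - i)]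
  field_simp

/-- The moments of the Volkenborn integral are the Bernoulli numbers. -/
theorem tendsto_powerMean (j : ℕ) :
    Tendsto (fun N => powerMean p N j) atTop (𝓝 ((bernoulli j : ℚ) : ℂ_[p])) := by
  simp only [powerMean_eq_sum_bernoulli]
  have hj : (j + 1 : ℂ_[p]) ≠ 0 := by exact_mod_cast j.succ_ne_zero
  have key : ((bernoulli j : ℚ) : ℂ_[p]) = ∑ i ∈ Finset.range (j + 1),
      ((bernoulli i : ℚ) : ℂ_[p]) * ((j + 1).choose i) * (0 : ℂ_[p]) ^ (j - i) / (j + 1) := by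
    rw [Finset.sum_range_succ, Finset.sum_eq_zero]
    · simp only [Nat.choose_succ_self_right, tsub_self, pow_zero]
      push_cast
      field_simp
      ring
    · intro i hi
      rw [zero_pow (by have := Finset.mem_range.1 hi; omega)]
      simp
  rw [key]
  refine tendsto_finsetSum _ fun i _ => ?_
  exact ((tendsto_natCast_pow_zero.pow _).const_mul _).div_const _

theorem norm_bernoulli_le (j : ℕ) : ‖((bernoulli j : ℚ) : ℂ_[p])‖ ≤ p :=
  le_of_tendsto (tendsto_powerMean j).norm (Eventually.of_forall fun N => norm_powerMean_le N j)

/-- The Bernoulli series of the partial zeta function is a Volkenborn integral: the series of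
`(1 + x u) ^ t` may be averaged over `x` term by term, since the moments are bounded by `p`. -/
theorem tendsto_mean_padicPow {t u : ℂ_[p]} (ht : ‖t‖ < radius p) (hu : ‖u‖ ≤ (q p : ℝ)⁻¹) :
    Tendsto (fun N => ((p ^ N : ℕ) : ℂ_[p])⁻¹ *
        ∑ x ∈ Finset.range (p ^ N), padicPow p (1 + x * u) t) atTop
      (𝓝 (∑' j : ℕ, Ring.choose t j * u ^ j * ((bernoulli j : ℚ) : ℂ_[p]))) := by
  have hxu (x : ℕ) : ‖(x : ℂ_[p]) * u‖ ≤ (q p : ℝ)⁻¹ := by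
    rw [norm_mul]
    exact (mul_le_of_le_one_left (norm_nonneg _)
      (IsUltrametricDist.norm_natCast_le_one _ _)).trans hu
  have e (N : ℕ) : ((p ^ N : ℕ) : ℂ_[p])⁻¹ *
      ∑ x ∈ Finset.range (p ^ N), padicPow p (1 + x * u) t =
      ∑' j : ℕ, Ring.choose t j * u ^ j * powerMean p N j := by
    simp only [padicPow, add_sub_cancel_left]
    rw [← Summable.tsum_finsetSum fun x _ => (summable_norm_choose_mul_pow ht (hxu x)).of_norm,
      ← tsum_mul_left]
    refine tsum_congr fun j => ?_
    rw [powerMean, Finset.mul_sum, Finset.mul_sum, Finset.mul_sum]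
    refine Finset.sum_congr rfl fun x _ => ?_
    ring
  simp only [e]
  refine tendsto_tsum_of_dominated_convergence (bound := fun j => ratio p t ^ j * p)
    ((summable_geometric_of_lt_one (ratio_nonneg t) (ratio_lt_one ht)).mul_right _)
    (fun j => (tendsto_powerMean j).const_mul _) (Eventually.of_forall fun N j => ?_)
  rw [norm_mul]
  exact mul_le_mul (norm_choose_mul_pow_le_ratio t hu j) (norm_powerMean_le N j) (norm_nonneg _)
    (pow_nonneg (ratio_nonneg t) _)

/-! ### The zeta sum as a limit of averages -/

theorem sum_Icc_one_eq_sum_range {M : Type*} [AddCommMonoid M] (g : ℕ → M) (n : ℕ) :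
    ∑ b ∈ Finset.Icc 1 n, g b = ∑ b ∈ Finset.range n, g (b + 1) := by
  induction n with
  | zero => simp
  | succ n ih => rw [Finset.sum_Icc_succ_top (by omega), ih, Finset.sum_range_succ]

theorem sum_Icc_one_mul_eq {M : Type*} [AddCommMonoid M] (g : ℕ → M) (F n : ℕ) :
    ∑ b ∈ Finset.Icc 1 (F * n), g b =
      ∑ a ∈ Finset.Icc 1 F, ∑ k ∈ Finset.range n, g (a + k * F) := by
  simp only [sum_Icc_one_eq_sum_range, sum_range_mul_eq, add_right_comm]

/-- The function `a ↦ χ(a) ⟨a⟩ ^ t` on the integers prime to `p`, extended by zero. -/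
def twist {f : ℕ} (χ : DirichletCharacter ℂ_[p] f) (t : ℂ_[p]) (a : ℕ) : ℂ_[p] :=
  if p ∣ a then 0 else χ (a : ZMod f) * padicPow p (angle p a) t

variable {f : ℕ} (χ : DirichletCharacter ℂ_[p] f) {t : ℂ_[p]} {F : ℕ}

theorem twist_of_dvd {a : ℕ} (ha : p ∣ a) : twist χ t a = 0 := if_pos ha

theorem twist_of_not_dvd {a : ℕ} (ha : ¬ p ∣ a) :
    twist χ t a = χ (a : ZMod f) * padicPow p (angle p a) t := if_neg ha

theorem dvd_add_mul_iff (hF : q p ∣ F) (a k : ℕ) : p ∣ a + k * F ↔ p ∣ a :=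
  (Nat.dvd_add_iff_left ((dvd_q.trans hF).mul_left k)).symm

theorem norm_twist_le_one (ht : ‖t‖ < radius p) (a : ℕ) : ‖twist χ t a‖ ≤ 1 := by
  by_cases ha : p ∣ a
  · rw [twist_of_dvd χ ha, norm_zero]; exact zero_le_one
  · rw [twist_of_not_dvd χ ha, norm_mul]
    exact mul_le_one₀ (χ.norm_le_one _) (norm_nonneg _)
      (norm_padicPow_le_one ht (norm_angle_sub_one_le ha))

theorem twist_add_mul (hF : q p ∣ F) (hfF : f ∣ F) (ht : ‖t‖ < radius p) (a k : ℕ) :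
    twist χ t (a + k * F) = twist χ t a * padicPow p (1 + k * (F / a : ℂ_[p])) t := by
  by_cases ha : p ∣ a
  · rw [twist_of_dvd χ ha, twist_of_dvd χ ((dvd_add_mul_iff hF a k).2 ha), zero_mul]
  · rw [twist_of_not_dvd χ ha, twist_of_not_dvd χ (mt (dvd_add_mul_iff hF a k).1 ha),
      padicPow_angle_add_mul hF ha k ht, mul_assoc]
    have : ((a + k * F : ℕ) : ZMod f) = a := by
      rw [Nat.cast_add, (ZMod.natCast_eq_zero_iff _ _).2 (hfF.mul_left k), add_zero]
    rw [this]

theorem twist_three_mul (h3 : ¬ p ∣ 3) (ht : ‖t‖ < radius p) (a : ℕ) :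
    twist χ t (3 * a) = χ (3 : ZMod f) * padicPow p (angle p 3) t * twist χ t a := by
  by_cases ha : p ∣ a
  · rw [twist_of_dvd χ ha, twist_of_dvd χ (ha.mul_left 3), mul_zero]
  · have h : ¬ p ∣ 3 * a := fun h => ((Fact.out : p.Prime).dvd_mul.1 h).elim h3 ha
    rw [twist_of_not_dvd χ ha, twist_of_not_dvd χ h, angle_mul,
      padicPow_mul ht (norm_angle_sub_one_le h3) (norm_angle_sub_one_le ha), Nat.cast_mul, map_mul,
      Nat.cast_ofNat]
    ring

/-- The zeta sum, up to the factor `s - 1`, is the limit of the averages of `χ(a) ⟨a⟩ ^ (1 - s)`. -/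
theorem tendsto_mean_twist (hF0 : F ≠ 0) (hF : q p ∣ F) (hfF : f ∣ F) {s : ℂ_[p]} (hs1 : s ≠ 1)
    (hs : ‖1 - s‖ < radius p) :
    Tendsto (fun N => ((F * p ^ N : ℕ) : ℂ_[p])⁻¹ *
        ∑ b ∈ Finset.Icc 1 (F * p ^ N), twist χ (1 - s) b) atTop
      (𝓝 ((s - 1) * zetaSum p χ F s)) := by
  have hFc : (F : ℂ_[p]) ≠ 0 := by exact_mod_cast hF0
  have hs1' : s - 1 ≠ 0 := sub_ne_zero.2 hs1
  have e1 (N : ℕ) : ((F * p ^ N : ℕ) : ℂ_[p])⁻¹ *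
      ∑ b ∈ Finset.Icc 1 (F * p ^ N), twist χ (1 - s) b =
      ∑ a ∈ Finset.Icc 1 F, (F : ℂ_[p])⁻¹ * twist χ (1 - s) a * (((p ^ N : ℕ) : ℂ_[p])⁻¹ *
        ∑ k ∈ Finset.range (p ^ N), padicPow p (1 + k * (F / a : ℂ_[p])) (1 - s)) := by
    rw [sum_Icc_one_mul_eq, Finset.mul_sum]
    refine Finset.sum_congr rfl fun a _ => ?_
    simp only [twist_add_mul χ hF hfF hs]
    rw [← Finset.mul_sum, Nat.cast_mul, mul_inv]
    ring
  have e2 : (s - 1) * zetaSum p χ F s = ∑ a ∈ Finset.Icc 1 F, (F : ℂ_[p])⁻¹ * twist χ (1 - s) a *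
      ∑' j : ℕ, Ring.choose (1 - s) j * (F / a : ℂ_[p]) ^ j * ((bernoulli j : ℚ) : ℂ_[p]) := by
    rw [zetaSum, Finset.sum_filter, Finset.mul_sum]
    refine Finset.sum_congr rfl fun a _ => ?_
    by_cases ha : p ∣ a
    · simp [twist_of_dvd χ ha, ha]
    · rw [twist_of_not_dvd χ ha, if_pos ha, partialZeta]
      field_simp
  simp only [e1, e2]
  refine tendsto_finsetSum _ fun a _ => ?_
  by_cases ha : p ∣ a
  · simp [twist_of_dvd χ ha]
  · refine (tendsto_mean_padicPow hs ?_).const_mul _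
    rw [norm_div_natCast ha]
    exact norm_natCast_le_of_q_dvd hF

/-! ### Multiplication by three -/

/-- For `r` modulo `F`, with `F` prime to `3`, the digit `k ∈ {0, 1, 2}` for which `r + k F` is
divisible by `3`. -/
def carry (F r : ℕ) : ℕ := 2 * F * r % 3

theorem carry_cases (hF3 : F % 3 ≠ 0) (r : ℕ) :
    (carry F r = 0 ∧ r % 3 = 0) ∨ (carry F r = 1 ∧ (r + F) % 3 = 0) ∨
      (carry F r = 2 ∧ (r + 2 * F) % 3 = 0) := by
  have h1 : F % 3 = 1 ∨ F % 3 = 2 := by omega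
  have h2 : r % 3 = 0 ∨ r % 3 = 1 ∨ r % 3 = 2 := by omega
  unfold carry
  rw [Nat.mul_mod, Nat.mul_mod 2 F]
  rcases h1 with h1 | h1 <;> rcases h2 with h2 | h2 | h2 <;> rw [h1, h2] <;> omega

theorem eps_eq_one_sub_carry {d : ℕ} (hF3 : F % 3 ≠ 0) (hd : F % 3 = d % 3) (r : ℕ) :
    eps d r = 1 - (carry F r : ℤ) := by
  rcases carry_cases hF3 r with ⟨h, h'⟩ | ⟨h, h'⟩ | ⟨h, h'⟩ <;> rw [h] <;> unfold eps <;>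
    split_ifs <;> omega

/-- Multiplication by `3` permutes the residues modulo `F`; the residue `r` comes from
`a = (r + carry F r * F) / 3`, which again lies between `1` and `F`. -/
theorem sum_three_mul {M : Type*} [AddCommMonoid M] (hF3 : F % 3 ≠ 0) (g : ℕ → M) :
    ∑ a ∈ Finset.Icc 1 F, g (3 * a) = ∑ r ∈ Finset.Icc 1 F, g (r + carry F r * F) := by
  symm
  refine Finset.sum_nbij' (fun r => (r + carry F r * F) / 3)
    (fun a => if 3 * a ≤ F then 3 * a else if 3 * a ≤ 2 * F then 3 * a - F else 3 * a - 2 * F)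
    ?_ ?_ ?_ ?_ ?_
  · intro r hr
    simp only [Finset.mem_Icc] at hr ⊢
    rcases carry_cases hF3 r with ⟨h, h'⟩ | ⟨h, h'⟩ | ⟨h, h'⟩ <;> rw [h] <;> omega
  · intro a ha
    simp only [Finset.mem_Icc] at ha ⊢
    split_ifs <;> omega
  · intro r hr
    simp only [Finset.mem_Icc] at hr
    rcases carry_cases hF3 r with ⟨h, h'⟩ | ⟨h, h'⟩ | ⟨h, h'⟩ <;> simp only [h] <;>
      split_ifs <;> omega
  · intro a ha
    simp only [Finset.mem_Icc] at ha
    set r := if 3 * a ≤ F then 3 * a else if 3 * a ≤ 2 * F then 3 * a - F else 3 * a - 2 * F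
      with hr
    rcases carry_cases hF3 r with ⟨h, h'⟩ | ⟨h, h'⟩ | ⟨h, h'⟩ <;> rw [h] <;>
      split_ifs at hr <;> omega
  · intro r hr
    congr 1
    rcases carry_cases hF3 r with ⟨h, h'⟩ | ⟨h, h'⟩ | ⟨h, h'⟩ <;> rw [h] <;> omega

/-- First-order expansion of `χ(a) ⟨a⟩ ^ t` along the progression `a + k F`. -/
theorem norm_twist_add_mul_sub_le (hF : q p ∣ F) (hfF : f ∣ F) (ht : ‖t‖ < radius p) (a k : ℕ) :
    ‖twist χ t (a + k * F) - twist χ t a - t * F * (k * (twist χ t a / a))‖ ≤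
      (q p * ‖(F : ℂ_[p])‖) ^ 2 := by
  by_cases ha : p ∣ a
  · rw [twist_of_dvd χ ha, twist_of_dvd χ ((dvd_add_mul_iff hF a k).2 ha)]
    simp only [sub_zero, zero_div, mul_zero, norm_zero]
    positivity
  · rw [twist_add_mul χ hF hfF ht]
    set u : ℂ_[p] := k * (F / a : ℂ_[p]) with hu
    have hnu : ‖u‖ ≤ ‖(F : ℂ_[p])‖ := by
      rw [hu, norm_mul, norm_div_natCast ha]
      exact mul_le_of_le_one_left (norm_nonneg _) (IsUltrametricDist.norm_natCast_le_one _ _)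
    have e : twist χ t a * padicPow p (1 + u) t - twist χ t a - t * F * (k * (twist χ t a / a)) =
        twist χ t a * (padicPow p (1 + u) t - 1 - t * (1 + u - 1)) := by
      rw [hu]; ring
    rw [e, norm_mul]
    refine (mul_le_of_le_one_left (norm_nonneg _) (norm_twist_le_one χ ht a)).trans ?_
    refine (norm_padicPow_sub_one_sub_le ht ?_).trans ?_
    · rw [add_sub_cancel_left]
      exact hnu.trans (norm_natCast_le_of_q_dvd hF)
    · rw [add_sub_cancel_left]
      gcongr

/-- Compare the averages of `a ↦ χ(a) ⟨a⟩ ^ t` and of its translate `a ↦ χ(3 a) ⟨3 a⟩ ^ t`: the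
latter is a multiple of the former, and `3 a = r + k F` makes the difference first-order in `F`. -/
theorem norm_mean_twist_add_le (hF0 : F ≠ 0) (hF : q p ∣ F) (hfF : f ∣ F) (hF3 : F % 3 ≠ 0)
    (h3 : ¬ p ∣ 3) (ht : ‖t‖ < radius p) :
    ‖(1 - χ (3 : ZMod f) * padicPow p (angle p 3) t) *
        ((F : ℂ_[p])⁻¹ * ∑ a ∈ Finset.Icc 1 F, twist χ t a) +
      t * ∑ a ∈ Finset.Icc 1 F, (carry F a : ℂ_[p]) * (twist χ t a / a)‖ ≤
      q p ^ 2 * ‖(F : ℂ_[p])‖ := by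
  have hFc : (F : ℂ_[p]) ≠ 0 := by exact_mod_cast hF0
  have hsum : χ (3 : ZMod f) * padicPow p (angle p 3) t * ∑ a ∈ Finset.Icc 1 F, twist χ t a =
      ∑ r ∈ Finset.Icc 1 F, twist χ t (r + carry F r * F) := by
    rw [← sum_three_mul hF3, Finset.mul_sum]
    exact Finset.sum_congr rfl fun a _ => (twist_three_mul χ h3 ht a).symm
  have e : (1 - χ (3 : ZMod f) * padicPow p (angle p 3) t) *
        ((F : ℂ_[p])⁻¹ * ∑ a ∈ Finset.Icc 1 F, twist χ t a) +
      t * ∑ a ∈ Finset.Icc 1 F, (carry F a : ℂ_[p]) * (twist χ t a / a) =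
      -((F : ℂ_[p])⁻¹ * ∑ r ∈ Finset.Icc 1 F, (twist χ t (r + carry F r * F) - twist χ t r -
        t * F * ((carry F r : ℂ_[p]) * (twist χ t r / r)))) := by
    rw [Finset.sum_sub_distrib, Finset.sum_sub_distrib, ← hsum, ← Finset.mul_sum]
    field_simp
    ring
  have hpos : 0 < ‖(F : ℂ_[p])‖ := norm_pos_iff.2 hFc
  rw [e, norm_neg, norm_mul, norm_inv, inv_mul_le_iff₀ hpos]
  refine IsUltrametricDist.norm_sum_le_of_forall_le_of_nonneg (by positivity) fun r _ => ?_
  refine (norm_twist_add_mul_sub_le χ hF hfF ht r _).trans_eq ?_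
  ring

/-! ### Evenness -/

/-- For even `χ`, the function `a ↦ χ(a) ⟨a⟩ ^ t / a` is odd under `a ↦ F - a`, up to `O(F)`. -/
theorem norm_twist_sub_div_add_le (hF : q p ∣ F) (hfF : f ∣ F) (heven : χ.Even)
    (ht : ‖t‖ < radius p) {a : ℕ} (haF : a ≤ F) :
    ‖twist χ t (F - a) / (F - a : ℕ) + twist χ t a / a‖ ≤ q p * ‖(F : ℂ_[p])‖ := by
  have hpF : p ∣ F := dvd_q.trans hF
  by_cases ha : p ∣ a
  · rw [twist_of_dvd χ ha, twist_of_dvd χ (Nat.dvd_sub hpF ha)]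
    simp only [zero_div, add_zero, norm_zero]
    positivity
  · have ha' : ¬ p ∣ F - a := fun h => ha (by simpa [Nat.sub_sub_self haF] using Nat.dvd_sub hpF h)
    have hχ : χ ((F - a : ℕ) : ZMod f) = χ (a : ZMod f) := by
      rw [Nat.cast_sub haF, (ZMod.natCast_eq_zero_iff _ _).2 hfF, zero_sub, heven.eval_neg]
    have h1 := natCast_ne_zero_of_not_dvd ha
    have h2 := natCast_ne_zero_of_not_dvd ha'
    have h2' : (F : ℂ_[p]) - a ≠ 0 := by rwa [← Nat.cast_sub haF]
    have e : twist χ t (F - a) / (F - a : ℕ) + twist χ t a / a =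
        twist χ t a * ((padicPow p (1 - F / a : ℂ_[p]) t - 1) / (F - a : ℕ) +
          (F : ℂ_[p]) / (a : ℂ_[p]) / (F - a : ℕ)) := by
      rw [twist_of_not_dvd χ ha, twist_of_not_dvd χ ha', hχ, padicPow_angle_sub hF ha haF ht,
        Nat.cast_sub haF]
      field_simp
      ring
    have hu : ‖1 - (F / a : ℂ_[p]) - 1‖ = ‖(F : ℂ_[p])‖ := by
      rw [sub_sub_cancel_left, norm_neg, norm_div_natCast ha]
    rw [e, norm_mul]
    refine (mul_le_of_le_one_left (norm_nonneg _) (norm_twist_le_one χ ht a)).trans ?_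
    refine (IsUltrametricDist.norm_add_le_max _ _).trans (max_le ?_ ?_)
    · rw [norm_div_natCast ha', ← hu]
      exact norm_padicPow_sub_one_le' ht (hu.trans_le (norm_natCast_le_of_q_dvd hF))
    · rw [norm_div_natCast ha', norm_div_natCast ha]
      exact le_mul_of_one_le_left (norm_nonneg _) (by exact_mod_cast q_pos)

theorem norm_two_mul_sum_twist_div_le (hF : q p ∣ F) (hfF : f ∣ F) (heven : χ.Even)
    (ht : ‖t‖ < radius p) :
    ‖2 * ∑ a ∈ Finset.Icc 1 F, twist χ t a / a‖ ≤ q p * ‖(F : ℂ_[p])‖ := by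
  -- The term at `a = F` vanishes, so the sum may be taken over `0 ≤ a ≤ F`.
  have h0 : ∑ a ∈ Finset.Icc 1 F, twist χ t a / a =
      ∑ a ∈ Finset.range (F + 1), twist χ t a / a := by
    rw [sum_Icc_one_eq_sum_range, Finset.sum_range_succ', twist_of_dvd χ (dvd_zero p), zero_div,
      add_zero]
  have h1 := Finset.sum_range_reflect (fun a => twist χ t a / (a : ℂ_[p])) (F + 1)
  simp only [Nat.add_sub_cancel] at h1
  rw [h0, two_mul]
  nth_rewrite 1 [← h1]
  rw [← Finset.sum_add_distrib]
  refine IsUltrametricDist.norm_sum_le_of_forall_le_of_nonneg (by positivity) fun a ha => ?_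
  exact norm_twist_sub_div_add_le χ hF hfF heven ht (Nat.lt_succ_iff.1 (Finset.mem_range.1 ha))

/-! ### The value at `s = 1` -/

theorem exists_tendsto_choose_succ_div (j : ℕ) :
    ∃ c : ℂ_[p], Tendsto (fun t : ℂ_[p] => t⁻¹ * Ring.choose t (j + 1)) (𝓝[≠] 0) (𝓝 c) := by
  refine ⟨_, Tendsto.congr' (f₁ := fun t : ℂ_[p] => (((j + 1).factorial : ℕ) : ℂ_[p])⁻¹ *
    ∏ i ∈ Finset.range j, (t - (i + 1 : ℕ))) ?_ (((Continuous.tendsto ?_ 0).mono_left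
      nhdsWithin_le_nhds))⟩
  · filter_upwards [self_mem_nhdsWithin] with t ht
    rw [choose_eq_prod, Finset.prod_range_succ', Nat.cast_zero, sub_zero]
    have : t ≠ 0 := ht
    field_simp
  · fun_prop

/-- A binomial series in the exponent `t`, with bounded coefficients, is differentiable at
`t = 0`. -/
theorem exists_hasDerivAt_tsum_choose {u : ℂ_[p]} (hu : ‖u‖ ≤ (q p : ℝ)⁻¹) {c : ℕ → ℂ_[p]}
    {C : ℝ} (hc : ∀ j, ‖c j‖ ≤ C) :
    ∃ D : ℂ_[p], HasDerivAt (fun t => ∑' j : ℕ, Ring.choose t j * u ^ j * c j) D 0 := by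
  choose δ hδ using exists_tendsto_choose_succ_div (p := p)
  refine ⟨∑' j : ℕ, δ j * u ^ (j + 1) * c (j + 1), ?_⟩
  have hC : 0 ≤ C := (norm_nonneg _).trans (hc 0)
  have hr0 : 0 ≤ 1 / radius p := div_nonneg zero_le_one radius_pos.le
  have hr1 : 1 / radius p < 1 := (div_lt_one radius_pos).2 one_lt_radius
  have hratio {t : ℂ_[p]} (ht : ‖t‖ ≤ 1) : ratio p t = 1 / radius p := by
    rw [ratio, max_eq_right ht]
  have hball : ∀ᶠ t : ℂ_[p] in 𝓝[≠] 0, ‖t‖ ≤ 1 := by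
    filter_upwards [mem_nhdsWithin_of_mem_nhds (Metric.closedBall_mem_nhds (0 : ℂ_[p]) one_pos)]
      with t ht
    simpa using ht
  rw [hasDerivAt_iff_tendsto_slope_zero]
  refine Tendsto.congr' (f₁ := fun t : ℂ_[p] =>
    ∑' j : ℕ, t⁻¹ * Ring.choose t (j + 1) * u ^ (j + 1) * c (j + 1)) ?_ ?_
  · filter_upwards [hball] with t ht
    have hsum : Summable fun j : ℕ => Ring.choose t j * u ^ j * c j := by
      refine Summable.of_norm_bounded (g := fun j => ratio p t ^ j * C)
        ((summable_geometric_of_lt_one (ratio_nonneg t)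
          (ratio_lt_one (ht.trans_lt one_lt_radius))).mul_right C) fun j => ?_
      rw [norm_mul]
      exact mul_le_mul (norm_choose_mul_pow_le_ratio t hu j) (hc j) (norm_nonneg _)
        (pow_nonneg (ratio_nonneg t) _)
    have h0 : ∑' j : ℕ, Ring.choose (0 : ℂ_[p]) j * u ^ j * c j = c 0 := by
      rw [tsum_eq_single 0]
      · simp
      · intro j hj
        rw [Ring.choose_zero_pos _ (Nat.pos_of_ne_zero hj), zero_mul, zero_mul]
    rw [zero_add, h0, hsum.tsum_eq_zero_add, Ring.choose_zero_right, pow_zero, one_mul, one_mul,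
      add_sub_cancel_left, smul_eq_mul, ← tsum_mul_left]
    simp only [mul_assoc]
  · refine tendsto_tsum_of_dominated_convergence (bound := fun j => (1 / radius p) ^ (j + 1) * C)
      ?_ (fun j => ((hδ j).mul_const _).mul_const _) ?_
    · exact (((summable_geometric_of_lt_one hr0 hr1).comp_injective
        (add_left_injective 1))).mul_right C
    · filter_upwards [hball, self_mem_nhdsWithin] with t ht ht0 j
      have ht0' : 0 < ‖t‖ := norm_pos_iff.2 ht0
      rw [norm_mul]
      refine mul_le_mul ?_ (hc _) (norm_nonneg _) (pow_nonneg hr0 _)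
      rw [mul_assoc, norm_mul, norm_inv, inv_mul_le_iff₀ ht0', ← hratio ht]
      refine (norm_choose_succ_mul_pow_le t u j).trans ?_
      gcongr
      exact mul_le_of_le_one_right (pow_nonneg (ratio_nonneg t) _)
        (pow_le_one₀ (by positivity) (q_mul_norm_le_one hu))

theorem exists_hasDerivAt_padicPow {x : ℂ_[p]} (hx : ‖x - 1‖ ≤ (q p : ℝ)⁻¹) :
    ∃ D : ℂ_[p], HasDerivAt (padicPow p x) D 0 := by
  obtain ⟨D, hD⟩ := exists_hasDerivAt_tsum_choose hx (c := fun _ => 1) (C := 1) (by simp)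
  refine ⟨D, hD.congr_of_eventuallyEq (Eventually.of_forall fun t => ?_)⟩
  simp only [mul_one, padicPow]

variable {f : ℕ} (χ : DirichletCharacter ℂ_[p] f) {F : ℕ}

theorem sum_range_eq_sum_zmod {M : Type*} [AddCommMonoid M] [NeZero F] (g : ZMod F → M) :
    ∑ a ∈ Finset.range F, g a = ∑ x : ZMod F, g x :=
  Finset.sum_nbij' (fun a => (a : ZMod F)) ZMod.val (by simp)
    (fun x _ => Finset.mem_range.2 (ZMod.val_lt x))
    (fun a ha => ZMod.val_cast_of_lt (Finset.mem_range.1 ha)) (by simp) (by simp)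

/-- Orthogonality for the character modulo `F` induced by `χ ≠ 1`. -/
theorem sum_twist_zero (hF0 : F ≠ 0) (hpF : p ∣ F) (hfF : f ∣ F)
    (hcop : ∀ a : ℕ, a.Coprime f → ¬ p ∣ a → a.Coprime F) (hχ : χ ≠ 1) :
    ∑ a ∈ Finset.Icc 1 F, twist χ 0 a = 0 := by
  have : NeZero F := ⟨hF0⟩
  set ψ := DirichletCharacter.changeLevel hfF χ with hψ
  have hψ1 : ψ ≠ 1 := fun h => hχ ((DirichletCharacter.changeLevel_eq_one_iff hfF).1 h)
  have htw (a : ℕ) : twist χ 0 a = ψ (a : ZMod F) := by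
    by_cases hc : a.Coprime F
    · have hpa : ¬ p ∣ a := fun h => (Fact.out : p.Prime).one_lt.ne'
        (Nat.dvd_one.1 (hc ▸ Nat.dvd_gcd h hpF))
      have := χ.changeLevel_eq_cast_of_dvd' hfF (a := a) (Nat.isCoprime_iff_coprime.2 hc)
      rw [twist_of_not_dvd χ hpa, padicPow_zero, mul_one, hψ]
      simpa using this.symm
    · rw [ψ.map_nonunit (mt (ZMod.isUnit_iff_coprime a F).1 hc)]
      by_cases hpa : p ∣ a
      · exact twist_of_dvd χ hpa
      · rw [twist_of_not_dvd χ hpa, χ.map_nonunit, zero_mul]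
        exact fun h => hc (hcop a ((ZMod.isUnit_iff_coprime a f).1 h) hpa)
  have h1 : ∑ a ∈ Finset.Icc 1 F, twist χ 0 a = ∑ a ∈ Finset.range F, twist χ 0 a := by
    rw [sum_Icc_one_eq_sum_range]
    have h2 := Finset.sum_range_succ (twist χ 0) F
    rw [Finset.sum_range_succ', twist_of_dvd χ hpF, twist_of_dvd χ (dvd_zero p)] at h2
    simpa using h2
  rw [h1]
  simp only [htw]
  rw [sum_range_eq_sum_zmod fun x => ψ x]
  exact MulChar.sum_eq_zero_of_ne_one hψ1

/-- The zeta sum is `-1 / (t F)` times a function of `t = 1 - s` that vanishes and is differentiable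
at `t = 0`. -/
theorem exists_tendsto_zetaSum (hF0 : F ≠ 0) (hF : q p ∣ F) (hfF : f ∣ F)
    (hcop : ∀ a : ℕ, a.Coprime f → ¬ p ∣ a → a.Coprime F) (hχ : χ ≠ 1) :
    ∃ ℓ : ℂ_[p], Tendsto (zetaSum p χ F) (𝓝[≠] 1) (𝓝 ℓ) := by
  have hB (a : ℕ) (ha : ¬ p ∣ a) := exists_hasDerivAt_tsum_choose (p := p) (u := (F / a : ℂ_[p]))
    ((norm_div_natCast ha _).trans_le (norm_natCast_le_of_q_dvd hF)) norm_bernoulli_le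
  have hA (a : ℕ) (ha : ¬ p ∣ a) := exists_hasDerivAt_padicPow (norm_angle_sub_one_le ha)
  set G : ℂ_[p] → ℂ_[p] := fun t => ∑ a ∈ Finset.Icc 1 F with ¬ p ∣ a,
    χ (a : ZMod f) * (padicPow p (angle p a) t *
      ∑' j : ℕ, Ring.choose t j * (F / a : ℂ_[p]) ^ j * ((bernoulli j : ℚ) : ℂ_[p])) with hG
  obtain ⟨D, hD⟩ : ∃ D, HasDerivAt G D 0 := by
    choose! A' hA' using hA
    choose! B' hB' using hB
    exact ⟨_, HasDerivAt.fun_sum fun a ha => (((hA' a (Finset.mem_filter.1 ha).2).mul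
      (hB' a (Finset.mem_filter.1 ha).2)).const_mul (χ (a : ZMod f)))⟩
  have hG0 : G 0 = 0 := by
    refine Eq.trans ?_ (sum_twist_zero χ hF0 (dvd_q.trans hF) hfF hcop hχ)
    simp only [hG]
    rw [Finset.sum_filter]
    refine Finset.sum_congr rfl fun a _ => ?_
    rw [tsum_eq_single 0]
    · by_cases ha : p ∣ a
      · simp [twist_of_dvd χ ha, ha]
      · simp [twist_of_not_dvd χ ha, ha]
    · intro j hj
      rw [Ring.choose_zero_pos _ (Nat.pos_of_ne_zero hj), zero_mul, zero_mul]
  rw [hasDerivAt_iff_tendsto_slope_zero] at hD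
  have hsub : Tendsto (fun s : ℂ_[p] => 1 - s) (𝓝[≠] 1) (𝓝[≠] 0) := by
    refine tendsto_nhdsWithin_iff.2 ⟨?_, ?_⟩
    · have : Tendsto (fun s : ℂ_[p] => 1 - s) (𝓝 1) (𝓝 (1 - 1)) :=
        tendsto_const_nhds.sub tendsto_id
      rw [sub_self] at this
      exact this.mono_left nhdsWithin_le_nhds
    · filter_upwards [self_mem_nhdsWithin] with s hs
      exact sub_ne_zero.2 (Ne.symm hs)
  refine ⟨_, Tendsto.congr' ?_ ((hD.comp hsub).const_mul (-(F : ℂ_[p])⁻¹))⟩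
  refine Eventually.of_forall fun s => ?_
  have h3 : (1 - s)⁻¹ = -(s - 1)⁻¹ := by rw [← neg_sub s 1, inv_neg]
  simp only [Function.comp, zero_add, hG0, sub_zero, smul_eq_mul]
  simp only [zetaSum, hG, Finset.mul_sum, h3, partialZeta]
  refine Finset.sum_congr rfl fun a _ => ?_
  ring

/-! ### The series expansion -/

/-- The moduli `lcm(q, f)` and `d p ^ N`, for large `N`, differ by a power of `p`. -/
theorem exists_lcm_q_eq {d : ℕ} (hd : d.Coprime p) (m : ℕ) :
    ∃ e, (q p).lcm (d * p ^ m) = d * p ^ e ∧ m ≤ e := by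
  obtain ⟨v, hv⟩ : ∃ v, q p = p ^ v := by
    unfold q; split_ifs with h
    · exact ⟨2, by subst h; norm_num⟩
    · exact ⟨1, (pow_one p).symm⟩
  refine ⟨max v m, Nat.dvd_antisymm ?_ ?_, le_max_right _ _⟩
  · refine Nat.lcm_dvd ?_ (Nat.mul_dvd_mul_left _ (pow_dvd_pow _ (le_max_right _ _)))
    rw [hv]
    exact (pow_dvd_pow _ (le_max_left _ _)).mul_left _
  · refine (hd.pow_right _).mul_dvd_of_dvd_of_dvd ?_ ?_
    · exact (dvd_mul_right _ _).trans (Nat.dvd_lcm_right _ _)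
    · rcases le_total v m with h | h
      · rw [max_eq_right h]
        exact (dvd_mul_left _ _).trans (Nat.dvd_lcm_right _ _)
      · rw [max_eq_left h, ← hv]
        exact Nat.dvd_lcm_left _ _

variable {d m : ℕ} (η : DirichletCharacter ℂ_[p] (d * p ^ m))

theorem mod_three_ne_zero {d p : ℕ} (h3 : Nat.Coprime 3 (d * p)) (N : ℕ) : d * p ^ N % 3 ≠ 0 := by
  intro h
  have h1 : Nat.Coprime 3 (d * p ^ N) :=
    (Nat.Coprime.coprime_mul_right_right h3).mul_right
      ((Nat.Coprime.coprime_mul_left_right h3).pow_right N)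
  exact absurd (Nat.Coprime.eq_one_of_dvd h1 (Nat.dvd_of_mod_eq_zero h)) (by norm_num)

/-- The exponent `2 n` is even so that `F = d p ^ (2 n)` is congruent to `d` modulo `3`. -/
theorem mul_pow_two_mul_mod_three {d p : ℕ} (h3 : Nat.Coprime 3 (d * p)) (n : ℕ) :
    d * p ^ (2 * n) % 3 = d % 3 := by
  have hp : p % 3 ≠ 0 := fun h => absurd (Nat.Coprime.eq_one_of_dvd
    (Nat.Coprime.coprime_mul_left_right h3) (Nat.dvd_of_mod_eq_zero h)) (by norm_num)
  have h2 : p ^ 2 % 3 = 1 := by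
    have : p % 3 = 1 ∨ p % 3 = 2 := by omega
    rcases this with h | h <;> simp [Nat.pow_mod, h]
  rw [pow_mul, Nat.mul_mod, Nat.pow_mod, h2]
  simp

theorem not_dvd_three (h3 : Nat.Coprime 3 (d * p)) : ¬ p ∣ 3 := fun h => by
  have := Nat.Coprime.coprime_mul_left_right h3
  exact (Fact.out : p.Prime).one_lt.ne' (Nat.Coprime.eq_one_of_dvd this.symm h)

theorem tendsto_sum_eps_twist_of_ne_one (hd : d.Coprime p) (h3 : Nat.Coprime 3 (d * p))
    (heven : η.Even) {s : ℂ_[p]} (hs : ‖1 - s‖ < radius p) (hs1 : s ≠ 1) :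
    Tendsto (fun n : ℕ => ∑ a ∈ Finset.Icc 1 (d * p ^ (2 * n)),
        ((eps d a : ℤ) : ℂ_[p]) * (twist η (1 - s) a / a)) atTop
      (𝓝 (-(1 - η (3 : ZMod (d * p ^ m)) * padicPow p (angle p 3) (1 - s)) *
        zetaSum p η ((q p).lcm (d * p ^ m)) s)) := by
  have hp := (Fact.out : p.Prime)
  have hd0 : d ≠ 0 := by
    rintro rfl
    exact hp.one_lt.ne' (by simpa using hd)
  obtain ⟨e, he, hme⟩ := exists_lcm_q_eq hd m
  have hqF : q p ∣ d * p ^ e := he ▸ Nat.dvd_lcm_left _ _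
  have hfF : d * p ^ m ∣ d * p ^ e := he ▸ Nat.dvd_lcm_right _ _
  have hF0 (N : ℕ) : d * p ^ N ≠ 0 := mul_ne_zero hd0 (pow_pos hp.pos N).ne'
  rw [he]
  have hdvd {n : ℕ} (hn : e ≤ n) : d * p ^ e ∣ d * p ^ (2 * n) :=
    Nat.mul_dvd_mul_left _ (pow_dvd_pow _ (by omega))
  have hmean := (tendsto_mean_twist η (hF0 e) hqF hfF hs1 hs).comp
    (tendsto_atTop_mono (fun n : ℕ => (by omega : n - e ≤ 2 * n - e)) (tendsto_sub_atTop_nat e))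
  have hmean' : Tendsto (fun n : ℕ => ((d * p ^ (2 * n) : ℕ) : ℂ_[p])⁻¹ *
      ∑ b ∈ Finset.Icc 1 (d * p ^ (2 * n)), twist η (1 - s) b) atTop
      (𝓝 ((s - 1) * zetaSum p η (d * p ^ e) s)) := by
    refine hmean.congr' ?_
    filter_upwards [eventually_ge_atTop e] with n hn
    have : d * p ^ e * p ^ (2 * n - e) = d * p ^ (2 * n) := by
      rw [mul_assoc, ← pow_add]; congr 2; omega
    simp only [Function.comp, this]
  have hFlim : Tendsto (fun n : ℕ => ((d * p ^ (2 * n) : ℕ) : ℂ_[p])) atTop (𝓝 0) := by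
    have := ((tendsto_natCast_pow_zero (p := p)).comp
      (tendsto_id.const_mul_atTop' (two_pos : 0 < 2))).const_mul (d : ℂ_[p])
    simpa [Function.comp] using this
  have hzero : Tendsto (fun n : ℕ => (1 - s) * ∑ a ∈ Finset.Icc 1 (d * p ^ (2 * n)),
        ((eps d a : ℤ) : ℂ_[p]) * (twist η (1 - s) a / a) -
      (1 - η (3 : ZMod (d * p ^ m)) * padicPow p (angle p 3) (1 - s)) *
        (((d * p ^ (2 * n) : ℕ) : ℂ_[p])⁻¹ *
          ∑ b ∈ Finset.Icc 1 (d * p ^ (2 * n)), twist η (1 - s) b)) atTop (𝓝 0) := by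
    have hbound : Tendsto (fun n : ℕ => (‖(1 - s) / 2‖ * q p + q p ^ 2) *
        ‖((d * p ^ (2 * n) : ℕ) : ℂ_[p])‖) atTop (𝓝 0) := by
      simpa using hFlim.norm.const_mul (‖(1 - s) / 2‖ * q p + q p ^ 2)
    refine squeeze_zero_norm' ?_ hbound
    filter_upwards [eventually_ge_atTop e] with n hn
    have hq := hqF.trans (hdvd hn)
    have hf := hfF.trans (hdvd hn)
    -- By evenness the plain sum of `χ(a) ⟨a⟩ ^ (1 - s) / a` is `O(F)`, also after division by `2`
    -- (with a larger constant if `p = 2`), so `-k` may be replaced by `ε = 1 - k`.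
    have b1 := norm_two_mul_sum_twist_div_le η hq hf heven hs
    have b2 := norm_mean_twist_add_le η (hF0 _) hq hf (mod_three_ne_zero h3 _)
      (not_dvd_three h3) hs
    have heps : ∑ a ∈ Finset.Icc 1 (d * p ^ (2 * n)),
        ((eps d a : ℤ) : ℂ_[p]) * (twist η (1 - s) a / a) =
        ∑ a ∈ Finset.Icc 1 (d * p ^ (2 * n)), twist η (1 - s) a / a -
        ∑ a ∈ Finset.Icc 1 (d * p ^ (2 * n)),
          (carry (d * p ^ (2 * n)) a : ℂ_[p]) * (twist η (1 - s) a / a) := by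
      rw [← Finset.sum_sub_distrib]
      refine Finset.sum_congr rfl fun a _ => ?_
      rw [eps_eq_one_sub_carry (mod_three_ne_zero h3 _) (mul_pow_two_mul_mod_three h3 n)]
      push_cast
      ring
    rw [heps]
    generalize ∑ a ∈ Finset.Icc 1 (d * p ^ (2 * n)), twist η (1 - s) a / a = S at b1 ⊢
    generalize ∑ a ∈ Finset.Icc 1 (d * p ^ (2 * n)),
      (carry (d * p ^ (2 * n)) a : ℂ_[p]) * (twist η (1 - s) a / a) = K at b2 ⊢
    generalize ((d * p ^ (2 * n) : ℕ) : ℂ_[p])⁻¹ *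
      ∑ a ∈ Finset.Icc 1 (d * p ^ (2 * n)), twist η (1 - s) a = A at b2 ⊢
    generalize 1 - η (3 : ZMod (d * p ^ m)) * padicPow p (angle p 3) (1 - s) = c at b2 ⊢
    have : (1 - s) * (S - K) - c * A = (1 - s) / 2 * (2 * S) - (c * A + (1 - s) * K) := by ring
    rw [this, add_mul]
    refine (norm_sub_le _ _).trans (add_le_add ?_ b2)
    rw [norm_mul, mul_assoc]
    gcongr
  have h1s : 1 - s ≠ 0 := sub_ne_zero.2 hs1.symm
  have hfin := (hzero.add (hmean'.const_mul
    (1 - η (3 : ZMod (d * p ^ m)) * padicPow p (angle p 3) (1 - s)))).const_mul (1 - s)⁻¹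
  simp only [sub_add_cancel, inv_mul_cancel_left₀ h1s] at hfin
  convert hfin using 2
  rw [zero_add]
  field_simp
  ring

/-- The finite sums are equicontinuous in `s` at `s = 1`. -/
theorem norm_sum_eps_twist_sub_le {s : ℂ_[p]} (hs : ‖1 - s‖ < radius p) (n : ℕ) :
    ‖∑ a ∈ Finset.Icc 1 n, ((eps d a : ℤ) : ℂ_[p]) * (twist χ (1 - s) a / a) -
      ∑ a ∈ Finset.Icc 1 n, ((eps d a : ℤ) : ℂ_[p]) * (twist χ 0 a / a)‖ ≤ ‖1 - s‖ := by
  rw [← Finset.sum_sub_distrib]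
  refine IsUltrametricDist.norm_sum_le_of_forall_le_of_nonneg (norm_nonneg _) fun a _ => ?_
  by_cases ha : p ∣ a
  · simp [twist_of_dvd χ ha]
  · have e : ((eps d a : ℤ) : ℂ_[p]) * (twist χ (1 - s) a / a) -
        ((eps d a : ℤ) : ℂ_[p]) * (twist χ 0 a / a) =
        ((eps d a : ℤ) : ℂ_[p]) * χ (a : ZMod f) *
          ((padicPow p (angle p a) (1 - s) - 1) / a) := by
      rw [twist_of_not_dvd χ ha, twist_of_not_dvd χ ha, padicPow_zero]
      ring
    rw [e, norm_mul, norm_mul, norm_div_natCast ha]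
    refine (mul_le_of_le_one_left (norm_nonneg _) (mul_le_one₀ ?_ (norm_nonneg _)
      (χ.norm_le_one _))).trans (norm_padicPow_sub_one_le hs (norm_angle_sub_one_le ha))
    exact IsUltrametricDist.norm_intCast_le_one _ _

theorem tendsto_sum_eps_twist_one (hd : d.Coprime p) (h3 : Nat.Coprime 3 (d * p))
    (heven : η.Even) {ℓ : ℂ_[p]}
    (hℓ : Tendsto (zetaSum p η ((q p).lcm (d * p ^ m))) (𝓝[≠] 1) (𝓝 ℓ)) :
    Tendsto (fun n : ℕ => ∑ a ∈ Finset.Icc 1 (d * p ^ (2 * n)),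
        ((eps d a : ℤ) : ℂ_[p]) * (twist η 0 a / a)) atTop
      (𝓝 (-(1 - η (3 : ZMod (d * p ^ m))) * ℓ)) := by
  have hsub : Tendsto (fun s : ℂ_[p] => ‖1 - s‖) (𝓝[≠] 1) (𝓝 0) := by
    have : Tendsto (fun s : ℂ_[p] => ‖1 - s‖) (𝓝 1) (𝓝 ‖(1 : ℂ_[p]) - 1‖) :=
      (tendsto_const_nhds.sub tendsto_id).norm
    rw [sub_self, norm_zero] at this
    exact this.mono_left nhdsWithin_le_nhds
  have hrad : ∀ᶠ s : ℂ_[p] in 𝓝[≠] 1, ‖1 - s‖ < radius p :=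
    hsub.eventually (gt_mem_nhds radius_pos)
  have hpow : Tendsto (fun s : ℂ_[p] => padicPow p (angle p 3) (1 - s)) (𝓝[≠] 1) (𝓝 1) := by
    rw [tendsto_iff_norm_sub_tendsto_zero]
    refine squeeze_zero' (Eventually.of_forall fun _ => norm_nonneg _) ?_ hsub
    filter_upwards [hrad] with s hs
    exact norm_padicPow_sub_one_le hs (norm_angle_sub_one_le (not_dvd_three h3))
  have hlim : Tendsto (fun s : ℂ_[p] =>
      -(1 - η (3 : ZMod (d * p ^ m)) * padicPow p (angle p 3) (1 - s)) *
        zetaSum p η ((q p).lcm (d * p ^ m)) s) (𝓝[≠] 1)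
      (𝓝 (-(1 - η (3 : ZMod (d * p ^ m))) * ℓ)) := by
    have := ((hpow.const_mul (η (3 : ZMod (d * p ^ m)))).const_sub 1).neg.mul hℓ
    rwa [mul_one] at this
  -- The pointwise limits for `s ≠ 1` tend to the claimed value, and by equicontinuity one `s` near
  -- `1` controls all the finite sums at `1`.
  rw [Metric.tendsto_atTop']
  intro ε hε
  have hε3 : 0 < ε / 3 := by positivity
  obtain ⟨s, hs, hs1, hsε, hsl⟩ := (hrad.and ((eventually_mem_nhdsWithin).and
    ((hsub.eventually (gt_mem_nhds hε3)).and
      (hlim.eventually (Metric.ball_mem_nhds _ hε3))))).exists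
  obtain ⟨N, hN⟩ := Metric.tendsto_atTop'.1
    (tendsto_sum_eps_twist_of_ne_one η hd h3 heven hs hs1) (ε / 3) hε3
  refine ⟨N, fun n hn => ?_⟩
  have h1 := (norm_sum_eps_twist_sub_le (d := d) η hs (d * p ^ (2 * n))).trans_lt hsε
  rw [← dist_eq_norm, dist_comm] at h1
  have h2 := hN n hn
  have h4 := dist_triangle4 (∑ a ∈ Finset.Icc 1 (d * p ^ (2 * n)),
    ((eps d a : ℤ) : ℂ_[p]) * (twist η 0 a / a)) _ _ (-(1 - η (3 : ZMod (d * p ^ m))) * ℓ)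
    |>.trans_lt (add_lt_add (add_lt_add h1 h2) (Metric.mem_ball.1 hsl))
  linarith

/-- The summand of the expansion is `ε_a χ(a) ⟨a⟩ ^ (1 - s) / a`, since
`ω(a) ⟨a⟩ ^ s ⟨a⟩ ^ (1 - s) = a`. -/
theorem sum_omega_inv_eq_sum_twist {s : ℂ_[p]} (hs : ‖s‖ < radius p)
    (hs' : ‖1 - s‖ < radius p) (n : ℕ) :
    ∑ a ∈ Finset.Icc 1 n with ¬ p ∣ a, χ (a : ZMod f) * (omega p a)⁻¹ *
        (((eps d a : ℤ) : ℂ_[p]) / padicPow p (angle p a) s) =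
      ∑ a ∈ Finset.Icc 1 n, ((eps d a : ℤ) : ℂ_[p]) * (twist χ (1 - s) a / a) := by
  rw [Finset.sum_filter]
  refine Finset.sum_congr rfl fun a _ => ?_
  by_cases ha : p ∣ a
  · simp [twist_of_dvd χ ha, ha]
  · rw [if_pos ha, twist_of_not_dvd χ ha]
    have h1 : padicPow p (angle p a) s * padicPow p (angle p a) (1 - s) = angle p a := by
      rw [← padicPow_add hs hs' (norm_angle_sub_one_le ha), add_sub_cancel]
      simpa using padicPow_natCast (angle p a) 1
    have h2 := omega_ne_zero ha
    have h3 := angle_ne_zero ha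
    have h4 : padicPow p (angle p a) s ≠ 0 := fun h => h3 (by rw [← h1, h, zero_mul])
    have h5 := natCast_ne_zero_of_not_dvd ha
    have h6 : (a : ℂ_[p]) = omega p a *
        (padicPow p (angle p a) s * padicPow p (angle p a) (1 - s)) := by
      rw [h1, omega_mul_angle ha]
    field_simp
    linear_combination (χ (a : ZMod f) * ((eps d a : ℤ) : ℂ_[p])) * h6

end PadicDirichlet

end

theorem mainTheorem7 (p : ℕ) [Fact p.Prime] (d m : ℕ) (hd : Nat.Coprime d p)
    (h3 : Nat.Coprime 3 (d * p))
    (χ : DirichletCharacter ℂ_[p] (d * p ^ m)) (hχ : χ.IsPrimitive) (heven : χ.Even)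
    (s : ℂ_[p]) (hs : ‖s‖ < PadicDirichlet.radius p) (hs1 : χ = 1 → s ≠ 1) :
    Tendsto
      (fun n : ℕ => ∑ a ∈ Finset.Icc 1 (d * p ^ (2 * n)) with ¬ p ∣ a,
        χ (a : ZMod (d * p ^ m)) * (PadicDirichlet.omega p a)⁻¹ *
          (((PadicDirichlet.eps d a : ℤ) : ℂ_[p]) /
            PadicDirichlet.padicPow p (PadicDirichlet.angle p a) s))
      atTop
      (𝓝 (-(1 - χ (3 : ZMod (d * p ^ m)) *
            PadicDirichlet.padicPow p (PadicDirichlet.angle p 3) (1 - s)) *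
          PadicDirichlet.padicL p χ s)) := by
  have hs' : ‖1 - s‖ < PadicDirichlet.radius p := by
    refine (PadicDirichlet.norm_sub_le_max _ _).trans_lt (max_lt ?_ hs)
    rw [norm_one]
    exact PadicDirichlet.one_lt_radius
  simp only [PadicDirichlet.sum_omega_inv_eq_sum_twist χ hs hs']
  by_cases h1 : s = 1
  · subst h1
    have hχ1 : χ ≠ 1 := fun h => hs1 h rfl
    obtain ⟨e, he, hme⟩ := PadicDirichlet.exists_lcm_q_eq hd m
    have hd0 : d ≠ 0 := by
      rintro rfl
      exact (Fact.out : p.Prime).one_lt.ne' (by simpa using hd)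
    obtain ⟨ℓ, hℓ⟩ := PadicDirichlet.exists_tendsto_zetaSum χ
      (Nat.lcm_ne_zero PadicDirichlet.q_pos.ne'
        (mul_ne_zero hd0 (pow_pos (Fact.out : p.Prime).pos m).ne'))
      (Nat.dvd_lcm_left _ _) (Nat.dvd_lcm_right _ _) (fun a ha hpa => by
        rw [he]
        exact (Nat.Coprime.coprime_mul_right_right ha).mul_right
          (((Nat.Prime.coprime_iff_not_dvd Fact.out).2 hpa).symm.pow_right e)) hχ1
    rw [PadicDirichlet.padicL, if_pos rfl, hℓ.limUnder_eq, sub_self,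
      PadicDirichlet.padicPow_zero, mul_one]
    exact PadicDirichlet.tendsto_sum_eps_twist_one χ hd h3 heven hℓ
  · rw [PadicDirichlet.padicL, if_neg h1]
    exact PadicDirichlet.tendsto_sum_eps_twist_of_ne_one χ hd h3 heven hs' h1
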